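/- Let $\pi:N\to B$ be a smooth locally trivial fiber bundle of closed manifolds, endowed with an Ehresmann connection $TN=VN\oplus\pi^*TB$, where $VN=\ker d\pi$. Let $\varepsilon>0$, $U=(-\varepsilon,0]\times N$ (a collar neighborhood of the boundary $\{r=0\}$ of a manifold with boundary $N$) and $U^c=(-\varepsilon,0)\times N$, with $r$ the first coordinate, so that $TU=\mathbb{R}\partial_r\oplus VN\oplus\pi^*TB$. Let $\varphi\in\Gamma(\mathrm{End}(TU))$ be multiplication by $r$ on $VN$ and the identity on $\mathbb{R}\partial_r\oplus\pi^*TB$; it is invertible over $U^c$. Let $g$ be a model edge metric on $U^c$, i.e. $$g=dr^2\oplus r^2g^V(r)\oplus\pi^*g^B,$$ where $g^B$ is a Riemannian metric on $B$ and $g^V(r)$, $r\in(-\varepsilon,0]$, is a family of metrics on $VN$ that is smooth down to $r=0$. For a Riemannian metric $\tilde g$ on $U^c$ put $\tilde g^{\varphi}(\cdot,\cdot)=\tilde g(\varphi^{-1}\cdot,\varphi^{-1}\cdot)$; call $\tilde g$ a perturbation of $g$ of first (resp. second) order if $\tilde g^{\varphi}=g^{\varphi}+r\alpha$ (resp. $\tilde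 g^{\varphi}=g^{\varphi}+r^2\alpha$) on $U^c$ for some symmetric bilinear form $\alpha$ on $TU$ that is smooth down to $r=0$. Let $\nabla^g$, $\nabla^{\tilde g}$ denote the Levi-Civita connections on $U^c$. Then: 1. The connection $\varphi\nabla^g\varphi^{-1}$ extends to a smooth connection on $TU$, down to $r=0$, and the extension is compatible with the metric $dr^2\oplus g^V(r)\oplus\pi^*g^B$, the smooth extension of $g^\varphi$ to $U$. 2. If $\tilde g$ is a first-order perturbation of $g$, then $\varphi\nabla^{\tilde g}\varphi^{-1}$ extends to a smooth connection on $TU$, down to $r=0$. 3. If $\tilde g$ is a second-order perturbation of $g$, then $\varphi\nabla^{\tilde g}\varphi^{-1}$ extends likewise, and the two extended connections coincide at $r=0$: $$\varphi\nabla^{\tilde g}\varphi^{-1}\big|_{r=0}=\varphi\nabla^{g}\varphi^{-1}\big|_{r=0}.$$ -/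

import Mathlib

open scoped Manifold ContDiff

set_option linter.unusedSectionVars false

noncomputable section

namespace EdgeMetric

universe u w

/-- The model with corners of the (boundaryless) cylinder `ℝ × N`, for `N` an `n`-manifold. -/
abbrev cylModel (n : ℕ) : ModelWithCorners ℝ (ℝ × EuclideanSpace ℝ (Fin n))
    (ModelProd ℝ (EuclideanSpace ℝ (Fin n))) :=
  𝓘(ℝ, ℝ).prod (𝓡 n)

/-- The collar `U = (-ε, 0] × N`, as a subset of `ℝ × N`. Smoothness, derivatives etc. on `U` are
always taken within `U`, i.e. they are smoothness and derivatives up to the boundary `r = 0`. -/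
def collar (N : Type u) (ε : ℝ) : Set (ℝ × N) := Set.Ioc (-ε) 0 ×ˢ Set.univ

/-- The open collar `Uᶜ = (-ε, 0) × N`, where `r ≠ 0`. -/
def openCollar (N : Type u) (ε : ℝ) : Set (ℝ × N) := Set.Ioo (-ε) 0 ×ˢ Set.univ

section FieldsAndForms

variable {n : ℕ} {N : Type u} [TopologicalSpace N] [ChartedSpace (EuclideanSpace ℝ (Fin n)) N]

/-- (Not necessarily continuous) vector fields on `ℝ × N`. -/
abbrev VField (n : ℕ) (N : Type u) [TopologicalSpace N]
    [ChartedSpace (EuclideanSpace ℝ (Fin n)) N] : Type u :=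
  Π p : ℝ × N, TangentSpace (cylModel n) p

/-- (Not necessarily continuous) fields of bilinear forms on the tangent spaces of `ℝ × N`. -/
abbrev FormField (n : ℕ) (N : Type u) [TopologicalSpace N]
    [ChartedSpace (EuclideanSpace ℝ (Fin n)) N] : Type u :=
  Π p : ℝ × N, TangentSpace (cylModel n) p →L[ℝ] TangentSpace (cylModel n) p →L[ℝ] ℝ

/-- Operators `Y ↦ ∇ Y` from vector fields to fields of endomorphisms of the tangent spaces.
As in Mathlib, `D Y p v` stands for `∇_v Y` at the point `p`. -/
abbrev ConnOp (n : ℕ) (N : Type u) [TopologicalSpace N]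
    [ChartedSpace (EuclideanSpace ℝ (Fin n)) N] : Type u :=
  VField n N → Π p : ℝ × N, TangentSpace (cylModel n) p →L[ℝ] TangentSpace (cylModel n) p

/-- The radial component `dr` of a tangent vector. -/
def dr (p : ℝ × N) : TangentSpace (cylModel n) p →L[ℝ] ℝ :=
  ContinuousLinearMap.fst ℝ ℝ (EuclideanSpace ℝ (Fin n))

/-- The component along `N` of a tangent vector. -/
def toN (p : ℝ × N) : TangentSpace (cylModel n) p →L[ℝ] TangentSpace (𝓡 n) p.2 :=
  ContinuousLinearMap.snd ℝ ℝ (EuclideanSpace ℝ (Fin n))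

/-- The inclusion of the tangent space of the slice `{r} × N`. -/
def fromN (p : ℝ × N) : TangentSpace (𝓡 n) p.2 →L[ℝ] TangentSpace (cylModel n) p :=
  ContinuousLinearMap.inr ℝ ℝ (EuclideanSpace ℝ (Fin n))

variable [IsManifold (𝓡 n) ∞ N]

/-- `X` is smooth on `s` (up to the boundary points contained in `s`). -/
def SmoothFieldOn (s : Set (ℝ × N)) (X : VField n N) : Prop :=
  ContMDiffOn (cylModel n) (cylModel n).tangent ∞
    (fun p => (⟨p, X p⟩ : TangentBundle (cylModel n) (ℝ × N))) s

/-- The field of bilinear forms `α` is smooth on `s` (up to the boundary points in `s`). -/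
def SmoothFormOn (s : Set (ℝ × N)) (α : FormField n N) : Prop :=
  ContMDiffOn (cylModel n)
    ((cylModel n).prod 𝓘(ℝ, (ℝ × EuclideanSpace ℝ (Fin n)) →L[ℝ]
      (ℝ × EuclideanSpace ℝ (Fin n)) →L[ℝ] ℝ)) ∞
    (fun p => Bundle.TotalSpace.mk' ((ℝ × EuclideanSpace ℝ (Fin n)) →L[ℝ]
      (ℝ × EuclideanSpace ℝ (Fin n)) →L[ℝ] ℝ)
      (E := fun q : ℝ × N => TangentSpace (cylModel n) q →L[ℝ]
        TangentSpace (cylModel n) q →L[ℝ] ℝ) p (α p)) s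

/-- `D` is a smooth connection (covariant derivative) on the tangent bundle of `ℝ × N` restricted
to `s`: it is additive and satisfies the Leibniz rule on vector fields that are smooth on `s`, and
`∇_X Y` is smooth on `s` if `X` and `Y` are. For `s` the collar, this is a smooth connection on the
tangent bundle of the manifold with boundary `(-ε, 0] × N`. -/
structure IsConnectionOn (s : Set (ℝ × N)) (D : ConnOp n N) : Prop where
  add : ∀ Y Y' : VField n N, SmoothFieldOn s Y → SmoothFieldOn s Y' → ∀ p ∈ s,
    D (fun q => Y q + Y' q) p = D Y p + D Y' p
  leibniz : ∀ (f : ℝ × N → ℝ) (Y : VField n N),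
    ContMDiffOn (cylModel n) 𝓘(ℝ, ℝ) ∞ f s → SmoothFieldOn s Y →
    ∀ p ∈ s, ∀ v : TangentSpace (cylModel n) p,
      D (fun q => f q • Y q) p v =
        f p • D Y p v + (mvfderivWithin (cylModel n) f s p v) • Y p
  smooth : ∀ X Y : VField n N, SmoothFieldOn s X → SmoothFieldOn s Y →
    SmoothFieldOn s (fun p => D Y p (X p))

/-- `D` is compatible with `g` on `s`: `v (g (Y, Z)) = g (∇_v Y, Z) + g (Y, ∇_v Z)`. -/
def IsMetricOn (s : Set (ℝ × N)) (g : FormField n N) (D : ConnOp n N) : Prop :=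
  ∀ Y Z : VField n N, SmoothFieldOn s Y → SmoothFieldOn s Z →
    ∀ p ∈ s, ∀ v : TangentSpace (cylModel n) p,
      mvfderivWithin (cylModel n) (fun q => g q (Y q) (Z q)) s p v =
        g p (D Y p v) (Z p) + g p (Y p) (D Z p v)

/-- `D` is torsion free on `s`: `∇_X Y - ∇_Y X = [X, Y]`. -/
def IsTorsionFreeOn (s : Set (ℝ × N)) (D : ConnOp n N) : Prop :=
  ∀ X Y : VField n N, SmoothFieldOn s X → SmoothFieldOn s Y → ∀ p ∈ s,
    D Y p (X p) - D X p (Y p) = VectorField.mlieBracketWithin (cylModel n) X Y s p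

/-- `D` is the Levi-Civita connection of `g` on `s`. -/
structure IsLeviCivitaOn (s : Set (ℝ × N)) (g : FormField n N) (D : ConnOp n N) : Prop where
  isConnection : IsConnectionOn s D
  metric : IsMetricOn s g D
  torsionFree : IsTorsionFreeOn s D

end FieldsAndForms

section Bundle

variable {n m : ℕ} {N : Type u} [TopologicalSpace N] [ChartedSpace (EuclideanSpace ℝ (Fin n)) N]
  {B : Type w} [TopologicalSpace B] [ChartedSpace (EuclideanSpace ℝ (Fin m)) B]

/-- `π : N → B` is a smooth locally trivial fiber bundle: every point of `B` has an open
neighbourhood over which `π` is diffeomorphic to a product with some manifold `F` (since the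
fibers are subsets of `N`, it is enough to let `F` range over the universe of `N`). -/
def IsSmoothFiberBundle (n m : ℕ) {N : Type u} [TopologicalSpace N]
    [ChartedSpace (EuclideanSpace ℝ (Fin n)) N] {B : Type w} [TopologicalSpace B]
    [ChartedSpace (EuclideanSpace ℝ (Fin m)) B] (π : N → B) : Prop :=
  ContMDiff (𝓡 n) (𝓡 m) ∞ π ∧
  ∀ b : B, ∃ (k : ℕ) (F : Type u) (_ : TopologicalSpace F)
    (_ : ChartedSpace (EuclideanSpace ℝ (Fin k)) F) (_ : IsManifold (𝓡 k) ∞ F)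
    (e : Bundle.Trivialization F π), b ∈ e.baseSet ∧
      ContMDiffOn (𝓡 n) ((𝓡 m).prod (𝓡 k)) ∞ e e.source ∧
      ContMDiffOn ((𝓡 m).prod (𝓡 k)) (𝓡 n) ∞ e.toOpenPartialHomeomorph.symm e.target

variable [IsManifold (𝓡 n) ∞ N] [IsManifold (𝓡 m) ∞ B]

/-- An Ehresmann connection on `π : N → B`: a smooth field of projectors of `TN` onto the
vertical bundle `VN = ker dπ`. Its kernel is the horizontal bundle, isomorphic to `π^*TB`. -/
structure EhresmannConnection (n m : ℕ) {N : Type u} [TopologicalSpace N]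
    [ChartedSpace (EuclideanSpace ℝ (Fin n)) N] [IsManifold (𝓡 n) ∞ N]
    {B : Type w} [TopologicalSpace B] [ChartedSpace (EuclideanSpace ℝ (Fin m)) B]
    (π : N → B) where
  proj : Π x : N, TangentSpace (𝓡 n) x →L[ℝ] TangentSpace (𝓡 n) x
  vertical : ∀ (x : N) (v : TangentSpace (𝓡 n) x), mfderiv (𝓡 n) (𝓡 m) π x (proj x v) = 0
  proj_eq_self : ∀ (x : N) (v : TangentSpace (𝓡 n) x),
    mfderiv (𝓡 n) (𝓡 m) π x v = 0 → proj x v = v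
  smooth : ContMDiff (𝓡 n)
    ((𝓡 n).prod 𝓘(ℝ, EuclideanSpace ℝ (Fin n) →L[ℝ] EuclideanSpace ℝ (Fin n))) ∞
    (fun x => Bundle.TotalSpace.mk' (EuclideanSpace ℝ (Fin n) →L[ℝ] EuclideanSpace ℝ (Fin n))
      (E := fun y : N => TangentSpace (𝓡 n) y →L[ℝ] TangentSpace (𝓡 n) y) x (proj x))

/-- A smooth family `g^V(r)`, `r ∈ (-ε, 0]`, of metrics on the vertical bundle of `π`, given by a
field of symmetric bilinear forms on the whole tangent bundle of `(-ε, 0] × N`, positive definite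
on vertical vectors. Only its values on vertical vectors matter below. -/
structure VerticalMetric (n m : ℕ) {N : Type u} [TopologicalSpace N]
    [ChartedSpace (EuclideanSpace ℝ (Fin n)) N] [IsManifold (𝓡 n) ∞ N]
    {B : Type w} [TopologicalSpace B] [ChartedSpace (EuclideanSpace ℝ (Fin m)) B]
    (π : N → B) (ε : ℝ) where
  form : FormField n N
  symm : ∀ p ∈ collar N ε, ∀ v v' : TangentSpace (cylModel n) p, form p v v' = form p v' v
  pos : ∀ p ∈ collar N ε, ∀ v : TangentSpace (𝓡 n) p.2,
    mfderiv (𝓡 n) (𝓡 m) π p.2 v = 0 → v ≠ 0 → 0 < form p (fromN p v) (fromN p v)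
  smooth : SmoothFormOn (collar N ε) form

/-- A smooth Riemannian metric on the base. -/
abbrev BaseMetric (m : ℕ) (B : Type w) [TopologicalSpace B]
    [ChartedSpace (EuclideanSpace ℝ (Fin m)) B] [IsManifold (𝓡 m) ∞ B] : Type w :=
  Bundle.ContMDiffRiemannianMetric (𝓡 m) ∞ (EuclideanSpace ℝ (Fin m))
    (fun b : B => TangentSpace (𝓡 m) b)

variable {π : N → B} {ε : ℝ}

/-- The projector of `T(ℝ × N) = ℝ ⊕ VN ⊕ π^*TB` onto the vertical bundle `VN`. -/
def vertProj (𝓔 : EhresmannConnection n m π) (p : ℝ × N) :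
    TangentSpace (cylModel n) p →L[ℝ] TangentSpace (cylModel n) p :=
  (fromN p).comp ((𝓔.proj p.2).comp (toN p))

/-- Multiplication by `c` on vertical vectors and by `1` on `ℝ ∂_r` and horizontal vectors. -/
def vertScale (𝓔 : EhresmannConnection n m π) (c : ℝ) (p : ℝ × N) :
    TangentSpace (cylModel n) p →L[ℝ] TangentSpace (cylModel n) p :=
  (ContinuousLinearMap.id ℝ (TangentSpace (cylModel n) p) - vertProj 𝓔 p) + c • vertProj 𝓔 p

/-- The endomorphism `φ`: multiplication by `r` on vertical vectors. -/
def phi (𝓔 : EhresmannConnection n m π) (p : ℝ × N) :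
    TangentSpace (cylModel n) p →L[ℝ] TangentSpace (cylModel n) p :=
  vertScale 𝓔 p.1 p

/-- The inverse `φ⁻¹`, meaningful where `r ≠ 0`. -/
def phiInv (𝓔 : EhresmannConnection n m π) (p : ℝ × N) :
    TangentSpace (cylModel n) p →L[ℝ] TangentSpace (cylModel n) p :=
  vertScale 𝓔 (p.1)⁻¹ p

/-- The pullback `(v, v') ↦ b (f v) (f v')` of a bilinear form. -/
def pullForm {S T : Type*} [AddCommGroup S] [Module ℝ S] [TopologicalSpace S]
    [AddCommGroup T] [Module ℝ T] [TopologicalSpace T]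
    (b : T →L[ℝ] T →L[ℝ] ℝ) (f : S →L[ℝ] T) : S →L[ℝ] S →L[ℝ] ℝ :=
  (ContinuousLinearMap.precomp ℝ f).comp (b.comp f)

/-- The form `dr² ⊕ c² g^V(r) ⊕ π^*g^B`. -/
def scaledForm (𝓔 : EhresmannConnection n m π) (gV : VerticalMetric n m π ε) (gB : BaseMetric m B)
    (c : ℝ) : FormField n N := fun p =>
  (pullForm (ContinuousLinearMap.mul ℝ ℝ) (dr p) :
      TangentSpace (cylModel n) p →L[ℝ] TangentSpace (cylModel n) p →L[ℝ] ℝ)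
    + c ^ 2 • pullForm (gV.form p) (vertProj 𝓔 p)
    + pullForm (gB.inner (π p.2)) ((mfderiv (𝓡 n) (𝓡 m) π p.2).comp (toN p))

theorem scaledForm_apply (𝓔 : EhresmannConnection n m π) (gV : VerticalMetric n m π ε)
    (gB : BaseMetric m B) (c : ℝ) (p : ℝ × N) (v v' : TangentSpace (cylModel n) p) :
    scaledForm 𝓔 gV gB c p v v' =
      dr p v * dr p v' + c ^ 2 * gV.form p (vertProj 𝓔 p v) (vertProj 𝓔 p v')
        + gB.inner (π p.2) (mfderiv (𝓡 n) (𝓡 m) π p.2 (toN p v))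
            (mfderiv (𝓡 n) (𝓡 m) π p.2 (toN p v')) :=
  rfl

/-- The model edge metric `h = dr² ⊕ r² g^V(r) ⊕ π^*g^B`. -/
def modelMetric (𝓔 : EhresmannConnection n m π) (gV : VerticalMetric n m π ε)
    (gB : BaseMetric m B) : FormField n N :=
  fun p => scaledForm 𝓔 gV gB p.1 p

/-- The metric `h^φ = dr² ⊕ g^V(r) ⊕ π^*g^B`, which extends `h (φ⁻¹ ·, φ⁻¹ ·)` to `r = 0`. -/
def modelMetricPhi (𝓔 : EhresmannConnection n m π) (gV : VerticalMetric n m π ε)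
    (gB : BaseMetric m B) : FormField n N :=
  scaledForm 𝓔 gV gB 1

theorem vertProj_vertProj (𝓔 : EhresmannConnection n m π) (p : ℝ × N)
    (v : TangentSpace (cylModel n) p) : vertProj 𝓔 p (vertProj 𝓔 p v) = vertProj 𝓔 p v := by
  have h := 𝓔.proj_eq_self p.2 _ (𝓔.vertical p.2 (toN p v))
  change fromN p (𝓔.proj p.2 (𝓔.proj p.2 (toN p v))) = fromN p (𝓔.proj p.2 (toN p v))
  rw [h]

theorem vertScale_apply (𝓔 : EhresmannConnection n m π) (c : ℝ) (p : ℝ × N)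
    (v : TangentSpace (cylModel n) p) :
    vertScale 𝓔 c p v = v - vertProj 𝓔 p v + c • vertProj 𝓔 p v := rfl

theorem vertProj_vertScale (𝓔 : EhresmannConnection n m π) (c : ℝ) (p : ℝ × N)
    (v : TangentSpace (cylModel n) p) :
    vertProj 𝓔 p (vertScale 𝓔 c p v) = c • vertProj 𝓔 p v := by
  rw [vertScale_apply, map_add, map_sub, map_smul, vertProj_vertProj, sub_self, zero_add]

theorem vertScale_vertScale (𝓔 : EhresmannConnection n m π) (c d : ℝ) (p : ℝ × N)
    (v : TangentSpace (cylModel n) p) :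
    vertScale 𝓔 c p (vertScale 𝓔 d p v) = vertScale 𝓔 (c * d) p v := by
  rw [vertScale_apply 𝓔 c, vertProj_vertScale, vertScale_apply, vertScale_apply, mul_smul]
  abel

/-- `φ⁻¹` is the two-sided inverse of `φ` where `r ≠ 0`. -/
theorem phi_phiInv (𝓔 : EhresmannConnection n m π) (p : ℝ × N) (hp : p.1 ≠ 0)
    (v : TangentSpace (cylModel n) p) :
    phi 𝓔 p (phiInv 𝓔 p v) = v ∧ phiInv 𝓔 p (phi 𝓔 p v) = v := by
  have h1 : vertScale 𝓔 1 p v = v := by rw [vertScale_apply, one_smul]; abel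
  constructor
  · rw [phi, phiInv, vertScale_vertScale, mul_inv_cancel₀ hp, h1]
  · rw [phi, phiInv, vertScale_vertScale, inv_mul_cancel₀ hp, h1]

/-- `h^φ` is `h (φ⁻¹ ·, φ⁻¹ ·)` where `r ≠ 0`. -/
theorem modelMetricPhi_eq (𝓔 : EhresmannConnection n m π) (gV : VerticalMetric n m π ε)
    (gB : BaseMetric m B) (p : ℝ × N) (hp : p.1 ≠ 0) (v v' : TangentSpace (cylModel n) p) :
    modelMetric 𝓔 gV gB p (phiInv 𝓔 p v) (phiInv 𝓔 p v') = modelMetricPhi 𝓔 gV gB p v v' := by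
  have hr : ∀ u : TangentSpace (cylModel n) p, dr p (phiInv 𝓔 p u) = dr p u := by
    intro u
    have h0 : dr p (vertProj 𝓔 p u) = 0 := rfl
    rw [phiInv, vertScale_apply, map_add, map_sub, map_smul, h0]
    simp
  have hB : ∀ u : TangentSpace (cylModel n) p,
      mfderiv (𝓡 n) (𝓡 m) π p.2 (toN p (phiInv 𝓔 p u)) =
        mfderiv (𝓡 n) (𝓡 m) π p.2 (toN p u) := by
    intro u
    have h0 : mfderiv (𝓡 n) (𝓡 m) π p.2 (toN p (vertProj 𝓔 p u)) = 0 :=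
      𝓔.vertical p.2 (toN p u)
    rw [phiInv, vertScale_apply, map_add, map_sub, map_smul, map_add, map_sub, map_smul, h0,
      smul_zero, sub_zero, add_zero]
  rw [modelMetric, modelMetricPhi, scaledForm_apply, scaledForm_apply, hr, hr, hB, hB, phiInv,
    vertProj_vertScale, vertProj_vertScale]
  simp only [map_smul, smul_apply, smul_eq_mul]
  field_simp

/-- `g` is a perturbation of order `k` of the model edge metric `h`: it is a metric for `r ≠ 0`,
and `g (φ⁻¹ ·, φ⁻¹ ·) = h (φ⁻¹ ·, φ⁻¹ ·) + r ^ k α` with a symmetric bilinear form `α` that is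
smooth up to `r = 0`. -/
structure IsPerturbation (𝓔 : EhresmannConnection n m π) (gV : VerticalMetric n m π ε)
    (gB : BaseMetric m B) (k : ℕ) (g : FormField n N) : Prop where
  symm : ∀ p ∈ openCollar N ε, ∀ v v' : TangentSpace (cylModel n) p, g p v v' = g p v' v
  pos : ∀ p ∈ openCollar N ε, ∀ v : TangentSpace (cylModel n) p, v ≠ 0 → 0 < g p v v
  exists_form : ∃ α : FormField n N, SmoothFormOn (collar N ε) α ∧
    (∀ p ∈ collar N ε, ∀ v v' : TangentSpace (cylModel n) p, α p v v' = α p v' v) ∧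
    ∀ p ∈ openCollar N ε, ∀ v v' : TangentSpace (cylModel n) p,
      g p (phiInv 𝓔 p v) (phiInv 𝓔 p v') =
        modelMetric 𝓔 gV gB p (phiInv 𝓔 p v) (phiInv 𝓔 p v') + p.1 ^ k * α p v v'

/-- `D` is a smooth connection on the tangent bundle of the collar `(-ε, 0] × N` that extends the
connection `φ ∇ φ⁻¹` from `r ≠ 0` down to `r = 0`. -/
structure IsSmoothExtension (𝓔 : EhresmannConnection n m π) (ε : ℝ) (nabla D : ConnOp n N) :
    Prop where
  isConnection : IsConnectionOn (collar N ε) D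
  eq_conj : ∀ Y : VField n N, SmoothFieldOn (collar N ε) Y → ∀ p ∈ openCollar N ε,
    ∀ v : TangentSpace (cylModel n) p,
      D Y p v = phi 𝓔 p (nabla (fun q => phiInv 𝓔 q (Y q)) p v)

end Bundle

end EdgeMetric

end

/-! Write h for the model metric, g for a perturbation with g^φ = h^φ + r^(j+1) α, and D = φ∇φ⁻¹ for
the conjugate of its Levi-Civita connection. The field D_X Y is determined by its pairings g^φ(D_X
Y, Z), and these equal g(∇_X(φ⁻¹Y), φ⁻¹Z), which the Koszul formula computes. Everything reduces to
counting powers of r in that formula.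

The count is done on adapted fields: vertical fields, ∂_r, and horizontal lifts of coordinate fields
of the base. On these φ acts as r^t, with t = 1 for vertical fields and t = 0 otherwise. Three facts
remove the negative powers of r from the contribution of h: brackets of adapted fields are vertical
(`IsAdapted.vertProj_bracket`), vertical and non-vertical fields are h^φ-orthogonal, and inner
products of horizontal lifts are pulled back from the base, so vertical derivatives kill them
(`IsAdapted.dirDeriv_modelMetricPhi_horizontal`). The terms in α have none of these cancellations
and lose at most one power of r. Hence `koszul_split`: twice the pairing is M + r^j Q, where M comes
from h alone and M, Q are smooth down to r = 0.

Since the pairing is tensorial in X, Z and obeys the Leibniz rule in Y, this passes from adapted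
fields to all fields (`hasPairing`). The form h^φ + r^(j+1) α is positive definite down to r = 0,
because it is h^φ there, so its inverse Gram matrix recovers D_X Y smoothly from the pairings
(`exists_isLocalExtension`). This gives the extension already for j = 0. Local extensions glue
because r < 0 is dense in the collar, and metric compatibility passes to r = 0 by the same density.
For j = 1 the remainder r Q and the term r² α vanish at r = 0, so both connections have the same
h^φ-pairings there (`IsSmoothExtension.eq_at_boundary`). -/

noncomputable section

namespace EdgeMetric

universe u w

open Set Filter Topology VectorField

/-! ### Calculus on the collar up to the boundary -/

section Collar

variable {n : ℕ} {N : Type u} [TopologicalSpace N] [ChartedSpace (EuclideanSpace ℝ (Fin n)) N]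
  {ε : ℝ}

theorem isOpen_openCollar : IsOpen (openCollar N ε) := isOpen_Ioo.prod isOpen_univ

theorem openCollar_subset_collar : openCollar N ε ⊆ collar N ε :=
  Set.prod_mono Ioo_subset_Ioc_self subset_rfl

theorem collar_mem_nhds {p : ℝ × N} (hp : p ∈ openCollar N ε) : collar N ε ∈ 𝓝 p :=
  mem_of_superset (isOpen_openCollar.mem_nhds hp) openCollar_subset_collar

theorem fst_ne_zero_of_mem {p : ℝ × N} (hp : p ∈ openCollar N ε) : p.1 ≠ 0 := hp.1.2.ne

theorem uniqueMDiffOn_collar : UniqueMDiffOn (cylModel n) (collar N ε) :=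
  (uniqueDiffOn_Ioc (-ε) 0).uniqueMDiffOn.prod uniqueMDiffOn_univ

theorem uniqueMDiffWithinAt_collar {p : ℝ × N} (hp : p ∈ collar N ε) :
    UniqueMDiffWithinAt (cylModel n) (collar N ε) p := uniqueMDiffOn_collar p hp

theorem collar_eq_or {p : ℝ × N} (hp : p ∈ collar N ε) : p ∈ openCollar N ε ∨ p.1 = 0 := by
  rcases hp.1.2.lt_or_eq with h | h
  · exact Or.inl ⟨⟨hp.1.1, h⟩, mem_univ _⟩
  · exact Or.inr h

theorem mvfderivWithin_openCollar (f : ℝ × N → ℝ) {p : ℝ × N} (hp : p ∈ openCollar N ε) :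
    mvfderivWithin (cylModel n) f (openCollar N ε) p =
      mvfderivWithin (cylModel n) f (collar N ε) p := by
  unfold mvfderivWithin
  rw [mfderivWithin_of_isOpen isOpen_openCollar hp, mfderivWithin_of_mem_nhds (collar_mem_nhds hp)]

theorem mlieBracketWithin_openCollar (X Y : VField n N) {p : ℝ × N} (hp : p ∈ openCollar N ε) :
    mlieBracketWithin (cylModel n) X Y (openCollar N ε) p =
      mlieBracketWithin (cylModel n) X Y (collar N ε) p := by
  rw [mlieBracketWithin_of_isOpen isOpen_openCollar hp,
    mlieBracketWithin_of_mem_nhds (collar_mem_nhds hp)]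

/-- The derivative of the function `f` along the vector field `X`, on the collar. -/
def dirDeriv (n : ℕ) {N : Type u} [TopologicalSpace N]
    [ChartedSpace (EuclideanSpace ℝ (Fin n)) N] (ε : ℝ) (f : ℝ × N → ℝ) (X : VField n N)
    (p : ℝ × N) : ℝ :=
  mvfderivWithin (cylModel n) f (collar N ε) p (X p)

/-- Real functions on `ℝ × N` that are smooth on `s`. -/
abbrev SmoothFunOn (n : ℕ) {N : Type u} [TopologicalSpace N]
    [ChartedSpace (EuclideanSpace ℝ (Fin n)) N] (s : Set (ℝ × N)) (f : ℝ × N → ℝ) : Prop :=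
  ContMDiffOn (cylModel n) 𝓘(ℝ, ℝ) ∞ f s

variable {s : Set (ℝ × N)} {f f' : ℝ × N → ℝ} {X Y Z : VField n N}

theorem SmoothFunOn.mdiff (hf : SmoothFunOn n s f) {p : ℝ × N} (hp : p ∈ s) :
    MDifferentiableWithinAt (cylModel n) 𝓘(ℝ, ℝ) f s p :=
  (hf p hp).mdifferentiableWithinAt (by simp)

theorem dirDeriv_add (hf : SmoothFunOn n (collar N ε) f) (hf' : SmoothFunOn n (collar N ε) f')
    {p : ℝ × N} (hp : p ∈ collar N ε) :
    dirDeriv n ε (fun q => f q + f' q) X p = dirDeriv n ε f X p + dirDeriv n ε f' X p := by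
  unfold dirDeriv
  rw [mvfderivWithin_fun_add (hf.mdiff hp) (hf'.mdiff hp) (uniqueMDiffWithinAt_collar hp)]
  rfl

theorem dirDeriv_mul (hf : SmoothFunOn n (collar N ε) f) (hf' : SmoothFunOn n (collar N ε) f')
    {p : ℝ × N} (hp : p ∈ collar N ε) :
    dirDeriv n ε (fun q => f q * f' q) X p =
      f p * dirDeriv n ε f' X p + f' p * dirDeriv n ε f X p := by
  unfold dirDeriv
  rw [mvfderivWithin_fun_mul (hf.mdiff hp) (hf'.mdiff hp) (uniqueMDiffWithinAt_collar hp)]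
  rfl

theorem mvfderivWithin_congr_nhds {f f' : ℝ × N → ℝ} {p : ℝ × N}
    (h : f =ᶠ[𝓝 p] f') :
    mvfderivWithin (cylModel n) f (collar N ε) p =
      mvfderivWithin (cylModel n) f' (collar N ε) p := by
  have h1 := h.eq_of_nhds
  have := (h.filter_mono nhdsWithin_le_nhds).mfderivWithin_eq (I := cylModel n)
    (I' := 𝓘(ℝ, ℝ)) (s := collar N ε) h1
  unfold mvfderivWithin
  ext v
  exact congrArg (fun T : TangentSpace (cylModel n) p →L[ℝ] ℝ => T v) this

theorem dirDeriv_congr {p : ℝ × N}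
    (h : f =ᶠ[𝓝 p] f') : dirDeriv n ε f X p = dirDeriv n ε f' X p := by
  unfold dirDeriv
  rw [mvfderivWithin_congr_nhds h]

theorem dirDeriv_const (c : ℝ) (p : ℝ × N) : dirDeriv n ε (fun _ => c) X p = 0 := by
  unfold dirDeriv
  rw [mvfderivWithin_const]
  rfl

theorem dirDeriv_fst {p : ℝ × N} (hp : p ∈ collar N ε) :
    dirDeriv n ε Prod.fst X p = dr p (X p) := by
  unfold dirDeriv mvfderivWithin
  have := mfderivWithin_fst (I := 𝓘(ℝ, ℝ)) (I' := 𝓡 n) (uniqueMDiffWithinAt_collar hp)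
  rw [this]
  rfl

theorem smoothFunOn_fst : SmoothFunOn n s Prod.fst := contMDiff_fst.contMDiffOn

theorem smoothFunOn_snd {g : N → ℝ} (hg : ContMDiff (𝓡 n) 𝓘(ℝ, ℝ) ∞ g) :
    SmoothFunOn n s (fun p => g p.2) := (hg.comp contMDiff_snd).contMDiffOn

theorem dirDeriv_snd {g : N → ℝ} (hg : ContMDiff (𝓡 n) 𝓘(ℝ, ℝ) ∞ g) {p : ℝ × N}
    (hp : p ∈ collar N ε) :
    dirDeriv n ε (fun p => g p.2) X p = mvfderiv (𝓡 n) g p.2 (toN p (X p)) := by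
  unfold dirDeriv
  have h1 : (fun p : ℝ × N => g p.2) = g ∘ Prod.snd := rfl
  rw [h1, mvfderiv_comp_mfderivWithin p (hg.mdifferentiable (by simp) _)
    mdifferentiableWithinAt_snd (uniqueMDiffWithinAt_collar hp),
    mfderivWithin_snd (uniqueMDiffWithinAt_collar hp)]
  rfl

variable [IsManifold (𝓡 n) ∞ N]

theorem SmoothFieldOn.mono {t : Set (ℝ × N)} (hX : SmoothFieldOn s X) (h : t ⊆ s) :
    SmoothFieldOn t X :=
  ContMDiffOn.mono hX h

theorem SmoothFieldOn.congr (hX : SmoothFieldOn s X) (h : ∀ p ∈ s, Y p = X p) : SmoothFieldOn s Y :=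
  ContMDiffOn.congr hX (fun p hp => by rw [h p hp])

theorem SmoothFieldOn.add (hX : SmoothFieldOn s X) (hY : SmoothFieldOn s Y) :
    SmoothFieldOn s (fun p => X p + Y p) := ContMDiffOn.add_section hX hY

theorem SmoothFieldOn.sub (hX : SmoothFieldOn s X) (hY : SmoothFieldOn s Y) :
    SmoothFieldOn s (fun p => X p - Y p) := ContMDiffOn.sub_section hX hY

theorem SmoothFieldOn.smul (hf : SmoothFunOn n s f) (hY : SmoothFieldOn s Y) :
    SmoothFieldOn s (fun p => f p • Y p) := ContMDiffOn.smul_section hf hY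

theorem SmoothFieldOn.sum {ι : Type*} (t : Finset ι) {X : ι → VField n N}
    (hX : ∀ i ∈ t, SmoothFieldOn s (X i)) :
    SmoothFieldOn s (fun p => ∑ i ∈ t, X i p) :=
  ContMDiffOn.sum_section (t := fun i => X i) hX

theorem SmoothFieldOn.mdiff (hX : SmoothFieldOn s X) {p : ℝ × N} (hp : p ∈ s) :
    MDifferentiableWithinAt (cylModel n) (cylModel n).tangent
      (fun p => (⟨p, X p⟩ : TangentBundle (cylModel n) (ℝ × N))) s p :=
  (hX p hp).mdifferentiableWithinAt (by simp)

instance isManifold_minSmoothness_two : IsManifold (cylModel n) (minSmoothness ℝ 2) (ℝ × N) :=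
  IsManifold.of_le (n := ∞) (by simpa using ENat.LEInfty.out)

instance isManifold_minSmoothness_three : IsManifold (cylModel n) (minSmoothness ℝ 3) (ℝ × N) :=
  IsManifold.of_le (n := ∞) (by simpa using ENat.LEInfty.out)

theorem SmoothFieldOn.bracket (hX : SmoothFieldOn (collar N ε) X)
    (hY : SmoothFieldOn (collar N ε) Y) :
    SmoothFieldOn (collar N ε) (mlieBracketWithin (cylModel n) X Y (collar N ε)) :=
  haveI : IsManifold (cylModel n) (∞ + 1) (ℝ × N) :=
    inferInstanceAs (IsManifold (cylModel n) ∞ (ℝ × N))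
  fun p hp => ContMDiffWithinAt.mlieBracketWithin_vectorField (n := ∞) (m := ∞)
    (hX p hp) (hY p hp) uniqueMDiffOn_collar hp (by simp)

theorem SmoothFieldOn.dr (hX : SmoothFieldOn s X) : SmoothFunOn n s (fun p => dr p (X p)) := by
  have h1 := (contMDiff_equivTangentBundleProd (n := ∞) (I := 𝓘(ℝ, ℝ)) (M := ℝ)
    (I' := 𝓡 n) (M' := N)).comp_contMDiffOn hX
  have h2 := (contMDiff_snd_tangentBundle_modelSpace ℝ 𝓘(ℝ, ℝ) (n := ∞)).comp_contMDiffOn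
    (contMDiff_fst.comp_contMDiffOn h1)
  exact h2

theorem SmoothFieldOn.toN (hX : SmoothFieldOn s X) :
    ContMDiffOn (cylModel n) (𝓡 n).tangent ∞
      (fun p => (⟨p.2, toN p (X p)⟩ : TangentBundle (𝓡 n) N)) s := by
  have h1 := (contMDiff_equivTangentBundleProd (n := ∞) (I := 𝓘(ℝ, ℝ)) (M := ℝ)
    (I' := 𝓡 n) (M' := N)).comp_contMDiffOn hX
  exact contMDiff_snd.comp_contMDiffOn h1

theorem smoothFieldOn_prod {a : ℝ × N → ℝ} {z : Π p : ℝ × N, TangentSpace (𝓡 n) p.2}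
    (ha : SmoothFunOn n s a) (hz : ContMDiffOn (cylModel n) (𝓡 n).tangent ∞
      (fun p => (⟨p.2, z p⟩ : TangentBundle (𝓡 n) N)) s) :
    SmoothFieldOn s (fun p => ((a p, z p) : ℝ × EuclideanSpace ℝ (Fin n))) := by
  have h0 : ContMDiffOn (cylModel n) 𝓘(ℝ, ℝ).tangent ∞
      (fun p : ℝ × N => (⟨p.1, a p⟩ : TangentBundle 𝓘(ℝ, ℝ) ℝ)) s := by
    intro p hp
    rw [Bundle.contMDiffWithinAt_totalSpace]
    refine ⟨contMDiff_fst.contMDiffAt.contMDiffWithinAt, ?_⟩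
    simpa using ha p hp
  exact (contMDiff_equivTangentBundleProd_symm (n := ∞) (I := 𝓘(ℝ, ℝ)) (M := ℝ)
    (I' := 𝓡 n) (M' := N)).comp_contMDiffOn
    (h0.prodMk hz)

theorem SmoothFunOn.dirDeriv (hf : SmoothFunOn n (collar N ε) f)
    (hX : SmoothFieldOn (collar N ε) X) : SmoothFunOn n (collar N ε) (dirDeriv n ε f X) := by
  have h1 := ContMDiffOn.contMDiffOn_tangentMapWithin (m := ∞) hf (by simp) uniqueMDiffOn_collar
  have h2 := h1.comp hX (fun p hp => hp)
  exact (contMDiff_snd_tangentBundle_modelSpace ℝ 𝓘(ℝ, ℝ) (n := ∞)).comp_contMDiffOn h2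

/-- The radial vector field `∂_r`. -/
def radial (n : ℕ) (N : Type u) [TopologicalSpace N]
    [ChartedSpace (EuclideanSpace ℝ (Fin n)) N] : VField n N :=
  fun _ => ((1, 0) : ℝ × EuclideanSpace ℝ (Fin n))

theorem smoothFieldOn_radial : SmoothFieldOn s (radial n N) :=
  smoothFieldOn_prod contMDiffOn_const (((Bundle.contMDiff_zeroSection ℝ
    (TangentSpace (𝓡 n) : N → Type)).comp contMDiff_snd).contMDiffOn)

/-- The identity [X,Y]f = X(Yf) - Y(Xf) is extracted from the Jacobi identity for X, Y, fZ with Z =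
∂_r: subtracting f times the Jacobi identity for X, Y, Z leaves it as the coefficient of Z, which
`dr` reads off. -/
theorem dirDeriv_bracket (hX : SmoothFieldOn (collar N ε) X) (hY : SmoothFieldOn (collar N ε) Y)
    (hf : SmoothFunOn n (collar N ε) f) {p : ℝ × N} (hp : p ∈ openCollar N ε) :
    dirDeriv n ε f (mlieBracketWithin (cylModel n) X Y (collar N ε)) p =
      dirDeriv n ε (dirDeriv n ε f Y) X p - dirDeriv n ε (dirDeriv n ε f X) Y p := by
  have hpc := openCollar_subset_collar hp
  set s := collar N ε with hs
  set Z := radial n N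
  have hZ : SmoothFieldOn s Z := smoothFieldOn_radial
  have hfZ : SmoothFieldOn s (f • Z) := hZ.smul hf
  have hu : UniqueMDiffWithinAt (cylModel n) s p := uniqueMDiffWithinAt_collar hpc
  have hcl : p ∈ closure (interior s) :=
    subset_closure (mem_interior_iff_mem_nhds.2 (collar_mem_nhds hp))
  have h2 : minSmoothness ℝ 2 ≤ (∞ : WithTop ℕ∞) := by simpa using ENat.LEInfty.out
  have key : ∀ W : VField n N, SmoothFieldOn s W → ∀ q ∈ s,
      mlieBracketWithin (cylModel n) W (f • Z) s q =
        (dirDeriv n ε f W • Z + f • mlieBracketWithin (cylModel n) W Z s) q := by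
    intro W hW q hq
    exact mlieBracketWithin_smul_right (hf.mdiff hq) (hZ.mdiff hq) (uniqueMDiffWithinAt_collar hq)
  have key2 : ∀ W W' : VField n N, SmoothFieldOn s W → SmoothFieldOn s W' →
      mlieBracketWithin (cylModel n) W (mlieBracketWithin (cylModel n) W' (f • Z) s) s p =
        dirDeriv n ε (dirDeriv n ε f W') W p • Z p
        + dirDeriv n ε f W' p • mlieBracketWithin (cylModel n) W Z s p
        + (dirDeriv n ε f W p • mlieBracketWithin (cylModel n) W' Z s p
        + f p • mlieBracketWithin (cylModel n) W (mlieBracketWithin (cylModel n) W' Z s) s p) := by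
    intro W W' hW hW'
    rw [mlieBracketWithin_congr (fun _ _ => rfl) rfl (key W' hW') (key W' hW' p hpc),
      mlieBracketWithin_add_right (W := dirDeriv n ε f W' • Z)
        (W₁ := f • mlieBracketWithin (cylModel n) W' Z s) ((hZ.smul (hf.dirDeriv hW')).mdiff hpc)
        (((hW'.bracket hZ).smul hf).mdiff hpc) hu,
      mlieBracketWithin_smul_right ((hf.dirDeriv hW').mdiff hpc) (hZ.mdiff hpc) hu,
      mlieBracketWithin_smul_right (hf.mdiff hpc) ((hW'.bracket hZ).mdiff hpc) hu]
    rfl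
  have J1 := leibniz_identity_mlieBracketWithin_apply uniqueMDiffOn_collar hcl hpc
    ((hX p hpc).of_le h2) ((hY p hpc).of_le h2) ((hfZ p hpc).of_le h2)
  have J2 := leibniz_identity_mlieBracketWithin_apply uniqueMDiffOn_collar hcl hpc
    ((hX p hpc).of_le h2) ((hY p hpc).of_le h2) ((hZ p hpc).of_le h2)
  rw [key2 X Y hX hY, key2 Y X hY hX, key _ (hX.bracket hY) p hpc] at J1
  rw [← hs] at J1 J2
  simp only [Pi.add_apply, Pi.smul_apply'] at J1
  -- The mixed terms (Xf)[Y,Z] and (Yf)[X,Z] occur on both sides of `J1` and cancel.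
  have J3 := congrArg (fun v => EdgeMetric.dr p v) J1
  have hZ1 : EdgeMetric.dr p (Z p) = 1 := rfl
  have J4 := congrArg (fun v => EdgeMetric.dr p v) J2
  simp only [map_add, map_smul, hZ1, smul_eq_mul] at J3 J4
  linear_combination f p * J4 - J3

theorem exists_bump [T2Space N] {x : N} {W : Set N} (hW : W ∈ 𝓝 x) :
    ∃ ψ : N → ℝ, ContMDiff (𝓡 n) 𝓘(ℝ, ℝ) ∞ ψ ∧ tsupport ψ ⊆ W ∧ ψ =ᶠ[𝓝 x] 1 := by
  obtain ⟨f, -, hf⟩ := (SmoothBumpFunction.nhds_basis_tsupport (I := 𝓡 n) x).mem_iff.1 hW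
  exact ⟨f, f.contMDiff, hf, f.eventuallyEq_one⟩

end Collar

/-! ### Smoothness and positivity of the model forms -/

section Forms

variable {n m : ℕ} {N : Type u} [TopologicalSpace N] [ChartedSpace (EuclideanSpace ℝ (Fin n)) N]
  [IsManifold (𝓡 n) ∞ N]
  {B : Type w} [TopologicalSpace B] [ChartedSpace (EuclideanSpace ℝ (Fin m)) B]
  [IsManifold (𝓡 m) ∞ B] {π : N → B} {ε : ℝ}
  {s : Set (ℝ × N)} {X Y Z : VField n N} {α : FormField n N}

theorem SmoothFormOn.apply (hα : SmoothFormOn s α) (hX : SmoothFieldOn s X)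
    (hY : SmoothFieldOn s Y) : SmoothFunOn n s (fun p => α p (X p) (Y p)) := by
  have h : ContMDiffOn (cylModel n) ((cylModel n).prod 𝓘(ℝ, ℝ)) ∞
      (fun p => Bundle.TotalSpace.mk' ℝ (E := Bundle.Trivial (ℝ × N) ℝ) p (α p (X p) (Y p))) s := by
    apply ContMDiffOn.clm_bundle_apply₂ (F₁ := ℝ × EuclideanSpace ℝ (Fin n))
      (F₂ := ℝ × EuclideanSpace ℝ (Fin n))
    · exact hα
    · exact hX
    · exact hY
  intro p hp
  have := h p hp
  simp only [Bundle.contMDiffWithinAt_totalSpace] at this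
  exact this.2

set_option synthInstance.maxHeartbeats 200000 in
theorem smoothFormOn_zero : SmoothFormOn s (0 : FormField n N) :=
  (Bundle.contMDiff_zeroSection ℝ (fun q : ℝ × N => TangentSpace (cylModel n) q →L[ℝ]
        TangentSpace (cylModel n) q →L[ℝ] ℝ)).contMDiffOn

theorem SmoothFieldOn.vertProj (𝓔 : EhresmannConnection n m π) (hX : SmoothFieldOn s X) :
    SmoothFieldOn s (fun p => vertProj 𝓔 p (X p)) := by
  have h1 := hX.toN
  have h2 : ContMDiffOn (cylModel n)
      ((𝓡 n).prod 𝓘(ℝ, EuclideanSpace ℝ (Fin n) →L[ℝ] EuclideanSpace ℝ (Fin n))) ∞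
    (fun p : ℝ × N =>
      Bundle.TotalSpace.mk' (EuclideanSpace ℝ (Fin n) →L[ℝ] EuclideanSpace ℝ (Fin n))
      (E := fun y : N => TangentSpace (𝓡 n) y →L[ℝ] TangentSpace (𝓡 n) y) p.2 (𝓔.proj p.2)) s :=
    (𝓔.smooth.comp contMDiff_snd).contMDiffOn
  exact smoothFieldOn_prod (a := fun _ => 0) contMDiffOn_const (ContMDiffOn.clm_bundle_apply h2 h1)

theorem SmoothFieldOn.phiInv (𝓔 : EhresmannConnection n m π)
    (hX : SmoothFieldOn (collar N ε) X) :
    SmoothFieldOn (openCollar N ε) (fun p => phiInv 𝓔 p (X p)) := by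
  have hX' := hX.mono openCollar_subset_collar
  have hV := hX'.vertProj 𝓔
  have hr : SmoothFunOn n (openCollar N ε) (fun p => (p.1)⁻¹) := fun p hp =>
    (contMDiff_fst.contMDiffAt.contMDiffWithinAt).inv₀ (fst_ne_zero_of_mem hp)
  exact (hX'.sub hV).add (hV.smul hr)

theorem contMDiff_baseInner (gB : BaseMetric m B) {M : Type*} {E : Type*} [NormedAddCommGroup E]
    [NormedSpace ℝ E] {H : Type*} [TopologicalSpace H] {I : ModelWithCorners ℝ E H}
    [TopologicalSpace M] [ChartedSpace H M] {t : Set M} {b : M → B}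
    {v v' : Π x : M, TangentSpace (𝓡 m) (b x)}
    (hv : ContMDiffOn I (𝓡 m).tangent ∞ (fun x => (⟨b x, v x⟩ : TangentBundle (𝓡 m) B)) t)
    (hv' : ContMDiffOn I (𝓡 m).tangent ∞ (fun x => (⟨b x, v' x⟩ : TangentBundle (𝓡 m) B)) t) :
    ContMDiffOn I 𝓘(ℝ, ℝ) ∞ (fun x => gB.inner (b x) (v x) (v' x)) t := by
  have hb : ContMDiffOn I (𝓡 m) ∞ b t := fun x hx => by
    have := hv x hx
    simp only [Bundle.contMDiffWithinAt_totalSpace] at this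
    exact this.1
  have h : ContMDiffOn I ((𝓡 m).prod 𝓘(ℝ, ℝ)) ∞
      (fun x => Bundle.TotalSpace.mk' ℝ (E := Bundle.Trivial B ℝ) (b x)
        (gB.inner (b x) (v x) (v' x))) t := by
    apply ContMDiffOn.clm_bundle_apply₂ (F₁ := EuclideanSpace ℝ (Fin m))
      (F₂ := EuclideanSpace ℝ (Fin m))
    · exact gB.contMDiff.comp_contMDiffOn hb
    · exact hv
    · exact hv'
  intro p hp
  have := h p hp
  simp only [Bundle.contMDiffWithinAt_totalSpace] at this
  exact this.2

theorem SmoothFieldOn.mfderiv_toN (hπ : ContMDiff (𝓡 n) (𝓡 m) ∞ π) (hX : SmoothFieldOn s X) :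
    ContMDiffOn (cylModel n) (𝓡 m).tangent ∞
      (fun p => (⟨π p.2, mfderiv (𝓡 n) (𝓡 m) π p.2 (EdgeMetric.toN p (X p))⟩ :
        TangentBundle (𝓡 m) B)) s :=
  (hπ.contMDiff_tangentMap (m := ∞) (by simp)).comp_contMDiffOn hX.toN

theorem smoothFunOn_modelMetricPhi (hπ : ContMDiff (𝓡 n) (𝓡 m) ∞ π) (𝓔 : EhresmannConnection n m π)
    (gV : VerticalMetric n m π ε) (gB : BaseMetric m B) (hX : SmoothFieldOn (collar N ε) X)
    (hY : SmoothFieldOn (collar N ε) Y) :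
    SmoothFunOn n (collar N ε) (fun p => modelMetricPhi 𝓔 gV gB p (X p) (Y p)) := by
  have h1 : SmoothFunOn n (collar N ε) (fun p => dr p (X p) * dr p (Y p)) := hX.dr.mul hY.dr
  have h2 := gV.smooth.apply (hX.vertProj 𝓔) (hY.vertProj 𝓔)
  have h3 := contMDiff_baseInner gB (hX.mfderiv_toN hπ) (hY.mfderiv_toN hπ)
  refine ((h1.add h2).add h3).congr ?_
  intro p hp
  rw [modelMetricPhi, scaledForm_apply]
  simp

theorem scaledForm_symm (𝓔 : EhresmannConnection n m π) (gV : VerticalMetric n m π ε)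
    (gB : BaseMetric m B) (c : ℝ) {p : ℝ × N} (hp : p ∈ collar N ε)
    (v v' : TangentSpace (cylModel n) p) :
    scaledForm 𝓔 gV gB c p v v' = scaledForm 𝓔 gV gB c p v' v := by
  rw [scaledForm_apply, scaledForm_apply, gV.symm p hp, gB.symm, mul_comm (dr p v)]

/-- The three summands are nonnegative, so a nonpositive sum makes each vanish. Then dr v = 0 and dπ
v = 0; the latter makes the component along N vertical, where the projector is the identity and g^V
is definite. -/
theorem scaledForm_pos (𝓔 : EhresmannConnection n m π) (gV : VerticalMetric n m π ε)
    (gB : BaseMetric m B) {c : ℝ} (hc : c ≠ 0) {p : ℝ × N} (hp : p ∈ collar N ε)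
    (v : TangentSpace (cylModel n) p) (hv : v ≠ 0) : 0 < scaledForm 𝓔 gV gB c p v v := by
  rw [scaledForm_apply]
  have h1 : 0 ≤ dr p v * dr p v := mul_self_nonneg _
  have h2 : 0 ≤ gV.form p (vertProj 𝓔 p v) (vertProj 𝓔 p v) := by
    by_cases h : 𝓔.proj p.2 (toN p v) = 0
    · have : vertProj 𝓔 p v = 0 := by
        change fromN p (𝓔.proj p.2 (toN p v)) = 0
        rw [h, map_zero]
      simp [this]
    · exact (gV.pos p hp _ (𝓔.vertical p.2 (toN p v)) h).le
  have h3 : 0 ≤ gB.inner (π p.2) (mfderiv (𝓡 n) (𝓡 m) π p.2 (toN p v))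
            (mfderiv (𝓡 n) (𝓡 m) π p.2 (toN p v)) := by
    by_cases h : mfderiv (𝓡 n) (𝓡 m) π p.2 (toN p v) = 0
    · simp [h]
    · exact (gB.pos _ _ h).le
  have hc2 : 0 < c ^ 2 := by positivity
  by_contra hle
  have e2 : 0 ≤ c ^ 2 * gV.form p (vertProj 𝓔 p v) (vertProj 𝓔 p v) := by positivity
  have d1 : dr p v = 0 := by
    have : dr p v * dr p v = 0 := by linarith
    simpa using this
  have d3 : mfderiv (𝓡 n) (𝓡 m) π p.2 (toN p v) = 0 := by
    by_contra h
    have := gB.pos _ _ h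
    linarith
  have d2 : toN p v = 0 := by
    by_contra h
    have hproj := 𝓔.proj_eq_self p.2 _ d3
    have := gV.pos p hp _ d3 h
    have e : vertProj 𝓔 p v = fromN p (toN p v) := by
      change fromN p (𝓔.proj p.2 (toN p v)) = _
      rw [hproj]
    rw [e] at e2 hle
    have : 0 < c ^ 2 * gV.form p (fromN p (toN p v)) (fromN p (toN p v)) := by positivity
    linarith
  exact hv (Prod.ext d1 d2)

theorem modelMetricPhi_pos (𝓔 : EhresmannConnection n m π) (gV : VerticalMetric n m π ε)
    (gB : BaseMetric m B) {p : ℝ × N} (hp : p ∈ collar N ε)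
    (v : TangentSpace (cylModel n) p) (hv : v ≠ 0) : 0 < modelMetricPhi 𝓔 gV gB p v v :=
  scaledForm_pos 𝓔 gV gB one_ne_zero hp v hv

/-- With α = 0 the model is a perturbation of itself of every order, so its own extension is an
instance of the statement on perturbations. -/
theorem isPerturbation_modelMetric (𝓔 : EhresmannConnection n m π) (gV : VerticalMetric n m π ε)
    (gB : BaseMetric m B) (k : ℕ) : IsPerturbation 𝓔 gV gB k (modelMetric 𝓔 gV gB) where
  symm p hp v v' := scaledForm_symm 𝓔 gV gB p.1 (openCollar_subset_collar hp) v v'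
  pos p hp v hv :=
    scaledForm_pos 𝓔 gV gB (fst_ne_zero_of_mem hp) (openCollar_subset_collar hp) v hv
  exists_form := ⟨0, smoothFormOn_zero, fun _ _ _ _ => rfl, fun p _ v v' => by
    change _ = _ + p.1 ^ k * 0
    simp⟩

end Forms

/-! ### Smoothness of inverse matrices -/

section MatrixInverse

variable {E : Type*} [NormedAddCommGroup E] [NormedSpace ℝ E] {H : Type*} [TopologicalSpace H]
  {I : ModelWithCorners ℝ E H} {M : Type*} [TopologicalSpace M] [ChartedSpace H M]
  {ι : Type*} [Fintype ι] [DecidableEq ι] {t : Set M}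

theorem contMDiffOn_det {A : M → Matrix ι ι ℝ}
    (hA : ∀ i j, ContMDiffOn I 𝓘(ℝ, ℝ) ∞ (fun x => A x i j) t) :
    ContMDiffOn I 𝓘(ℝ, ℝ) ∞ (fun x => (A x).det) t := by
  simp only [Matrix.det_apply']
  exact contMDiffOn_finsetSum fun σ _ => contMDiffOn_const.mul
    (contMDiffOn_finsetProd fun i _ => hA _ _)

/-- Cramer's rule: the entries of the adjugate are determinants. -/
theorem contMDiffOn_matrix_inv {A : M → Matrix ι ι ℝ}
    (hA : ∀ i j, ContMDiffOn I 𝓘(ℝ, ℝ) ∞ (fun x => A x i j) t) (hdet : ∀ x ∈ t, (A x).det ≠ 0)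
    (i j : ι) : ContMDiffOn I 𝓘(ℝ, ℝ) ∞ (fun x => (A x)⁻¹ i j) t := by
  simp only [Matrix.inv_def, Matrix.smul_apply, Matrix.adjugate_apply,
    Ring.inverse_eq_inv', smul_eq_mul]
  refine ContMDiffOn.mul (fun x hx => (contMDiffOn_det hA x hx).inv₀ (hdet x hx))
    (contMDiffOn_det fun k l => ?_)
  by_cases h : k = j
  · subst h
    simp only [Matrix.updateRow_self]
    exact contMDiffOn_const
  · simp only [Matrix.updateRow_ne h]
    exact hA k l

end MatrixInverse

/-! ### Global fields, functions and frames obtained by cut-off -/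

section Frames

variable {n : ℕ} {N : Type u} [TopologicalSpace N] [ChartedSpace (EuclideanSpace ℝ (Fin n)) N]
  [IsManifold (𝓡 n) ∞ N]

/-- The axioms of a connection concern fields smooth on the whole collar, so locally defined fields
have to be cut off, at the price of shrinking the neighbourhood on which they keep their values. -/
theorem exists_eventuallyEq_field [T2Space N] {W : Set N} (hW : IsOpen W) {x : N} (hx : x ∈ W)
    {z : Π x : N, TangentSpace (𝓡 n) x} (hz : ContMDiffOn (𝓡 n) (𝓡 n).tangent ∞
      (fun x => (⟨x, z x⟩ : TangentBundle (𝓡 n) N)) W) :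
    ∃ z' : Π x : N, TangentSpace (𝓡 n) x, ContMDiff (𝓡 n) (𝓡 n).tangent ∞
      (fun x => (⟨x, z' x⟩ : TangentBundle (𝓡 n) N)) ∧ ∀ᶠ y in 𝓝 x, z' y = z y := by
  obtain ⟨ψ, h1, h2, h3⟩ := exists_bump (n := n) (hW.mem_nhds hx)
  refine ⟨ψ • z, ContMDiffOn.smul_section_of_tsupport h1.contMDiffOn hW h2 hz, ?_⟩
  filter_upwards [h3] with y hy
  change ψ y • z y = z y
  rw [hy, Pi.one_apply, one_smul]

theorem exists_eventuallyEq_fun [T2Space N] {W : Set N} (hW : IsOpen W) {x : N} (hx : x ∈ W)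
    {f : N → ℝ} (hf : ContMDiffOn (𝓡 n) 𝓘(ℝ, ℝ) ∞ f W) :
    ∃ f' : N → ℝ, ContMDiff (𝓡 n) 𝓘(ℝ, ℝ) ∞ f' ∧ f' =ᶠ[𝓝 x] f := by
  obtain ⟨ψ, h1, h2, h3⟩ := exists_bump (n := n) (hW.mem_nhds hx)
  refine ⟨fun y => ψ y • f y, contMDiff_of_tsupport fun y hy => ?_, ?_⟩
  · have hy' : y ∈ W := h2 (closure_mono (Function.support_smul_subset_left _ _) hy)
    exact (h1 y).smul ((hf y hy').contMDiffAt (hW.mem_nhds hy'))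
  · filter_upwards [h3] with y hy
    rw [hy, Pi.one_apply, one_smul]

theorem exists_field_through [T2Space N] (x : N) (v : TangentSpace (𝓡 n) x) :
    ∃ z : Π x : N, TangentSpace (𝓡 n) x, ContMDiff (𝓡 n) (𝓡 n).tangent ∞
      (fun x => (⟨x, z x⟩ : TangentBundle (𝓡 n) N)) ∧ z x = v := by
  obtain ⟨s, hs, h⟩ := FiberBundle.exists_contMDiffOn_extend (k := ∞) (𝓡 n)
    (EuclideanSpace ℝ (Fin n)) (V := TangentSpace (𝓡 n)) v
  obtain ⟨z, hz, hzx⟩ := exists_eventuallyEq_field isOpen_interior (mem_interior_iff_mem_nhds.2 hs)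
    (h.mono interior_subset)
  exact ⟨z, hz, by rw [hzx.self_of_nhds]; simp⟩

theorem exists_frame [T2Space N] (x₀ : N) :
    ∃ (z : Fin n → Π x : N, TangentSpace (𝓡 n) x) (O : Set N), IsOpen O ∧ x₀ ∈ O ∧
      (∀ i, ContMDiff (𝓡 n) (𝓡 n).tangent ∞ (fun x => (⟨x, z i x⟩ : TangentBundle (𝓡 n) N))) ∧
      ∀ x ∈ O, ∃ b : Module.Basis (Fin n) ℝ (TangentSpace (𝓡 n) x), ∀ i, b i = z i x := by
  let e := trivializationAt (EuclideanSpace ℝ (Fin n)) (TangentSpace (𝓡 n)) x₀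
  let b := (EuclideanSpace.basisFun (Fin n) ℝ).toBasis
  have h0 : x₀ ∈ e.baseSet := FiberBundle.mem_baseSet_trivializationAt' x₀
  have h := fun i => exists_eventuallyEq_field (n := n) e.open_baseSet h0
    (e.contMDiffOn_localFrame_baseSet ∞ b i)
  choose z hz hze using h
  refine ⟨z, interior {x | x ∈ e.baseSet ∧ ∀ i, z i x = e.localFrame b i x}, isOpen_interior,
    mem_interior_iff_mem_nhds.2 ?_, hz, fun x hx => ?_⟩
  · filter_upwards [e.open_baseSet.mem_nhds h0, eventually_all.2 hze] with y h1 h2 using ⟨h1, h2⟩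
  · have hx := interior_subset hx
    exact ⟨e.basisAt b hx.1, fun i => by rw [hx.2 i, e.localFrame_apply_of_mem_baseSet b hx.1]⟩

theorem contMDiff_mvfderiv_apply {g : N → ℝ} (hg : ContMDiff (𝓡 n) 𝓘(ℝ, ℝ) ∞ g)
    {z : Π x : N, TangentSpace (𝓡 n) x}
    (hz : ContMDiff (𝓡 n) (𝓡 n).tangent ∞ (fun x => (⟨x, z x⟩ : TangentBundle (𝓡 n) N))) :
    ContMDiff (𝓡 n) 𝓘(ℝ, ℝ) ∞ (fun x => mvfderiv (𝓡 n) g x (z x)) :=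
  (contMDiff_snd_tangentBundle_modelSpace ℝ 𝓘(ℝ, ℝ) (n := ∞)).comp
    ((hg.contMDiff_tangentMap (m := ∞) (by simp)).comp hz)

end Frames

/-! ### Horizontal lifts of coordinate fields of the base -/

section AdaptedFrame

variable {n m : ℕ} {N : Type u} [TopologicalSpace N] [ChartedSpace (EuclideanSpace ℝ (Fin n)) N]
  [IsManifold (𝓡 n) ∞ N]
  {B : Type w} [TopologicalSpace B] [ChartedSpace (EuclideanSpace ℝ (Fin m)) B]
  [IsManifold (𝓡 m) ∞ B] {π : N → B}

/-- In a local trivialization π becomes the first projection. -/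
theorem IsSmoothFiberBundle.mfderiv_surjective (hπ : IsSmoothFiberBundle n m π) (x : N) :
    Function.Surjective (mfderiv (𝓡 n) (𝓡 m) π x) := by
  obtain ⟨k, F, _, _, _, e, hb, he, he'⟩ := hπ.2 (π x)
  have hx : x ∈ e.source := e.mem_source.2 hb
  have hex : e x ∈ e.target := e.map_source hx
  have hsymm : e.toOpenPartialHomeomorph.symm (e x) = x := e.left_inv hx
  have h1 : MDifferentiableAt ((𝓡 m).prod (𝓡 k)) (𝓡 n) e.toOpenPartialHomeomorph.symm (e x) :=
    ((he' _ hex).contMDiffAt (e.open_target.mem_nhds hex)).mdifferentiableAt (by simp)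
  have h2 : MDifferentiableAt (𝓡 n) (𝓡 m) π (e.toOpenPartialHomeomorph.symm (e x)) :=
    hπ.1.mdifferentiable (by simp) _
  have h3 := mfderiv_comp (e x) h2 h1
  have h4 : π ∘ e.toOpenPartialHomeomorph.symm =ᶠ[𝓝 (e x)] Prod.fst := by
    filter_upwards [e.open_target.mem_nhds hex] with y hy using e.proj_symm_apply hy
  rw [h4.mfderiv_eq, mfderiv_fst, hsymm] at h3
  intro v
  refine ⟨mfderiv ((𝓡 m).prod (𝓡 k)) (𝓡 n) e.toOpenPartialHomeomorph.symm (e x)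
    ((v, 0) : EuclideanSpace ℝ (Fin m) × EuclideanSpace ℝ (Fin k)), ?_⟩
  have h5 := congrArg (fun T : EuclideanSpace ℝ (Fin m) × EuclideanSpace ℝ (Fin k) →L[ℝ]
    EuclideanSpace ℝ (Fin m) => T (v, 0)) h3
  exact h5.symm

/-- Horizontal vector fields on `N` that over `O` project to coordinate vector fields of a chart of
the base, together with the pullbacks of the coordinate functions. -/
structure AdaptedFrame (𝓔 : EhresmannConnection n m π) (gB : BaseMetric m B) (O : Set N) where
  coord : Fin m → N → ℝ
  field : Fin m → Π x : N, TangentSpace (𝓡 n) x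
  isOpen : IsOpen O
  contMDiff_coord : ∀ a, ContMDiff (𝓡 n) 𝓘(ℝ, ℝ) ∞ (coord a)
  contMDiff_field : ∀ a, ContMDiff (𝓡 n) (𝓡 n).tangent ∞
    (fun x => (⟨x, field a x⟩ : TangentBundle (𝓡 n) N))
  proj_field : ∀ a, ∀ x ∈ O, 𝓔.proj x (field a x) = 0
  mvfderiv_coord_field : ∀ a b, ∀ x ∈ O,
    mvfderiv (𝓡 n) (coord a) x (field b x) = (1 : Matrix (Fin m) (Fin m) ℝ) a b
  vertical_iff : ∀ x ∈ O, ∀ v : TangentSpace (𝓡 n) x,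
    mfderiv (𝓡 n) (𝓡 m) π x v = 0 ↔ ∀ a, mvfderiv (𝓡 n) (coord a) x v = 0
  mvfderiv_inner : ∀ a b, ∀ x ∈ O, ∀ v : TangentSpace (𝓡 n) x,
    mfderiv (𝓡 n) (𝓡 m) π x v = 0 →
    mvfderiv (𝓡 n) (fun y => gB.inner (π y) (mfderiv (𝓡 n) (𝓡 m) π y (field a y))
      (mfderiv (𝓡 n) (𝓡 m) π y (field b y))) x v = 0

theorem exists_coord [T2Space N] (hπ : ContMDiff (𝓡 n) (𝓡 m) ∞ π) (x₀ : N) :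
    ∃ (u : Fin m → N → ℝ) (O : Set N), IsOpen O ∧ x₀ ∈ O ∧
      (∀ x ∈ O, π x ∈ (chartAt (EuclideanSpace ℝ (Fin m)) (π x₀)).source) ∧
      (∀ a, ContMDiff (𝓡 n) 𝓘(ℝ, ℝ) ∞ (u a)) ∧
      ∀ x ∈ O, ∀ (v : TangentSpace (𝓡 n) x) (a : Fin m), mvfderiv (𝓡 n) (u a) x v =
        (show EuclideanSpace ℝ (Fin m) from
          mfderiv (𝓡 m) (𝓡 m) (extChartAt (𝓡 m) (π x₀)) (π x) (mfderiv (𝓡 n) (𝓡 m) π x v)) a := by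
  set c := extChartAt (𝓡 m) (π x₀) with hc
  have hopen : IsOpen (π ⁻¹' (chartAt (EuclideanSpace ℝ (Fin m)) (π x₀)).source) :=
    (chartAt (EuclideanSpace ℝ (Fin m)) (π x₀)).open_source.preimage hπ.continuous
  have hx₀ : x₀ ∈ π ⁻¹' (chartAt (EuclideanSpace ℝ (Fin m)) (π x₀)).source :=
    mem_chart_source _ _
  have hcπ : ContMDiffOn (𝓡 n) (𝓡 m) ∞ (c ∘ π)
      (π ⁻¹' (chartAt (EuclideanSpace ℝ (Fin m)) (π x₀)).source) :=
    (contMDiffOn_extChartAt (I := 𝓡 m) (x := π x₀)).comp hπ.contMDiffOn (fun _ h => h)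
  have hcomp : ∀ a : Fin m, ContMDiffOn (𝓡 n) 𝓘(ℝ, ℝ) ∞ (fun x => c (π x) a)
      (π ⁻¹' (chartAt (EuclideanSpace ℝ (Fin m)) (π x₀)).source) := fun a =>
    (EuclideanSpace.proj a : EuclideanSpace ℝ (Fin m) →L[ℝ] ℝ).contMDiff.comp_contMDiffOn hcπ
  choose u hu hue using fun a => exists_eventuallyEq_fun hopen hx₀ (hcomp a)
  have hall := (eventually_all.2 hue).and (hopen.mem_nhds hx₀)
  refine ⟨u, interior {x | (∀ a, u a x = c (π x) a) ∧
      π x ∈ (chartAt (EuclideanSpace ℝ (Fin m)) (π x₀)).source}, isOpen_interior,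
    mem_interior_iff_mem_nhds.2 hall, fun x hx => (interior_subset hx).2, hu, ?_⟩
  intro x hx v a
  have hx' := (interior_subset hx).2
  have h1 : u a =ᶠ[𝓝 x] (EuclideanSpace.proj a : EuclideanSpace ℝ (Fin m) →L[ℝ] ℝ) ∘ (c ∘ π) := by
    filter_upwards [mem_interior_iff_mem_nhds.1 hx] with y hy using hy.1 a
  have d1 : MDifferentiableAt (𝓡 n) (𝓡 m) π x := hπ.mdifferentiable (by simp) x
  have d2 : MDifferentiableAt (𝓡 m) (𝓡 m) c (π x) := mdifferentiableAt_extChartAt hx'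
  have d3 := (EuclideanSpace.proj a : EuclideanSpace ℝ (Fin m) →L[ℝ] ℝ).mdifferentiableAt
    (x := (c ∘ π) x)
  unfold mvfderiv
  rw [h1.mfderiv_eq, mfderiv_comp x d3 (d2.comp x d1), mfderiv_comp x d2 d1,
    ContinuousLinearMap.mfderiv_eq]
  rfl

/-- Fields dual to the pulled-back coordinate differentials at the base point are made dual nearby
by inverting the matrix of pairings, then made horizontal. Duality forces them to project to the
coordinate fields of the chart. -/
theorem exists_adaptedFrame [T2Space N] (hπ : IsSmoothFiberBundle n m π)
    (𝓔 : EhresmannConnection n m π) (gB : BaseMetric m B) (x₀ : N) :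
    ∃ O : Set N, x₀ ∈ O ∧ Nonempty (AdaptedFrame 𝓔 gB O) := by
  obtain ⟨u, O₁, hO₁, hx₁, hsrc, hu, hdu⟩ := exists_coord (m := m) hπ.1 x₀
  set c := extChartAt (𝓡 m) (π x₀) with hc
  have hinv : ∀ x ∈ O₁, (mfderiv (𝓡 m) (𝓡 m) c (π x)).IsInvertible := fun x hx =>
    isInvertible_mfderiv_extChartAt (by rw [extChartAt_source]; exact hsrc x hx)
  -- the coordinate differentials detect vertical vectors
  have hvert : ∀ x ∈ O₁, ∀ v : TangentSpace (𝓡 n) x,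
      mfderiv (𝓡 n) (𝓡 m) π x v = 0 ↔ ∀ a, mvfderiv (𝓡 n) (u a) x v = 0 := by
    intro x hx v
    constructor
    · intro h a
      rw [hdu x hx, h, map_zero]
      rfl
    · intro h
      have h1 : mfderiv (𝓡 m) (𝓡 m) c (π x) (mfderiv (𝓡 n) (𝓡 m) π x v) = 0 := by
        refine PiLp.ext (p := 2) (x := (show EuclideanSpace ℝ (Fin m) from _))
          (y := (0 : EuclideanSpace ℝ (Fin m))) fun a => ?_
        have := h a
        rw [hdu x hx] at this
        exact this
      exact (hinv x hx).injective (by rw [h1, map_zero])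
  -- fields with the prescribed projection at the base point
  have hlift : ∀ b : Fin m, ∃ v : TangentSpace (𝓡 n) x₀, ∀ a, mvfderiv (𝓡 n) (u a) x₀ v =
      (1 : Matrix (Fin m) (Fin m) ℝ) a b := by
    intro b
    obtain ⟨w, hw⟩ := (hinv x₀ hx₁).surjective (EuclideanSpace.single b (1 : ℝ))
    obtain ⟨v, hv⟩ := hπ.mfderiv_surjective x₀ w
    refine ⟨v, fun a => ?_⟩
    rw [hdu x₀ hx₁, hv, hw]
    simp [Matrix.one_apply]
  choose v₀ hv₀ using hlift
  choose z hz hzx using fun b => exists_field_through (n := n) x₀ (v₀ b)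
  let A : N → Matrix (Fin m) (Fin m) ℝ := fun x a b => mvfderiv (𝓡 n) (u a) x (z b x)
  have hA : ∀ a b, ContMDiff (𝓡 n) 𝓘(ℝ, ℝ) ∞ (fun x => A x a b) := fun a b =>
    contMDiff_mvfderiv_apply (hu a) (hz b)
  have hA₀ : A x₀ = 1 := by
    ext a b
    change mvfderiv (𝓡 n) (u a) x₀ (z b x₀) = _
    rw [hzx, hv₀]
  have hdetc : Continuous fun x => (A x).det :=
    (contMDiffOn_univ.1 (contMDiffOn_det fun a b => (hA a b).contMDiffOn)).continuous
  set W := O₁ ∩ {x | (A x).det ≠ 0} with hWdef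
  have hW : IsOpen W := hO₁.inter (isOpen_ne_fun hdetc continuous_const)
  have hxW : x₀ ∈ W := ⟨hx₁, by simp [hA₀]⟩
  let L : Fin m → Π x : N, TangentSpace (𝓡 n) x := fun b x => ∑ k, (A x)⁻¹ k b • z k x
  have hL : ∀ b, ContMDiffOn (𝓡 n) (𝓡 n).tangent ∞
      (fun x => (⟨x, L b x⟩ : TangentBundle (𝓡 n) N)) W := fun b =>
    ContMDiffOn.sum_section (t := fun k x => (A x)⁻¹ k b • z k x) fun k _ =>
      ContMDiffOn.smul_section (contMDiffOn_matrix_inv (fun a b => (hA a b).contMDiffOn)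
        (fun x hx => hx.2) k b) (hz k).contMDiffOn
  have hLu : ∀ a b, ∀ x ∈ W, mvfderiv (𝓡 n) (u a) x (L b x) =
      (1 : Matrix (Fin m) (Fin m) ℝ) a b := by
    intro a b x hx
    rw [map_sum, ← Matrix.mul_nonsing_inv (A x) (isUnit_iff_ne_zero.2 hx.2), Matrix.mul_apply]
    refine Finset.sum_congr rfl fun k _ => ?_
    rw [map_smul, smul_eq_mul, mul_comm]
  -- Removing the vertical part keeps duality, since the coordinate differentials vanish on vertical
  -- vectors.
  let H : Fin m → Π x : N, TangentSpace (𝓡 n) x := fun b x => L b x - 𝓔.proj x (L b x)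
  have hH : ∀ b, ContMDiffOn (𝓡 n) (𝓡 n).tangent ∞
      (fun x => (⟨x, H b x⟩ : TangentBundle (𝓡 n) N)) W := fun b =>
    ContMDiffOn.sub_section (hL b) (ContMDiffOn.clm_bundle_apply 𝓔.smooth.contMDiffOn (hL b))
  have hHu : ∀ a b, ∀ x ∈ W, mvfderiv (𝓡 n) (u a) x (H b x) =
      (1 : Matrix (Fin m) (Fin m) ℝ) a b := by
    intro a b x hx
    rw [map_sub, hLu a b x hx, (hvert x hx.1 _).1 (𝓔.vertical x (L b x)) a, sub_zero]
  choose F hF hFe using fun b => exists_eventuallyEq_field hW hxW (hH b)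
  have hnear : {x | x ∈ W ∧ ∀ b, F b x = H b x} ∈ 𝓝 x₀ := by
    filter_upwards [hW.mem_nhds hxW, eventually_all.2 hFe] with x h1 h2 using ⟨h1, h2⟩
  refine ⟨interior {x | x ∈ W ∧ ∀ b, F b x = H b x}, mem_interior_iff_mem_nhds.2 hnear,
    ⟨{ coord := u, field := F, isOpen := isOpen_interior, contMDiff_coord := hu
       contMDiff_field := hF, proj_field := ?_, mvfderiv_coord_field := ?_
       vertical_iff := fun x hx => hvert x (interior_subset hx).1.1, mvfderiv_inner := ?_ }⟩⟩
  · intro a x hx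
    have hx := interior_subset hx
    rw [hx.2 a, map_sub, 𝓔.proj_eq_self x _ (𝓔.vertical x (L a x)), sub_self]
  · intro a b x hx
    have hx := interior_subset hx
    rw [hx.2 b, hHu a b x hx.1]
  · intro a b x hx v hv
    let e := trivializationAt (EuclideanSpace ℝ (Fin m)) (TangentSpace (𝓡 m)) (π x₀)
    let β := (EuclideanSpace.basisFun (Fin m) ℝ).toBasis
    have hbase : e.baseSet = (chartAt (EuclideanSpace ℝ (Fin m)) (π x₀)).source :=
      TangentBundle.trivializationAt_baseSet (π x₀)
    -- Both sides have the same image under the derivative of the chart of B, which is injective.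
    have hproj : ∀ y ∈ interior {x | x ∈ W ∧ ∀ b, F b x = H b x}, ∀ d,
        mfderiv (𝓡 n) (𝓡 m) π y (F d y) = e.localFrame β d (π y) := by
      intro y hy d
      have hy := interior_subset hy
      have hyb : π y ∈ e.baseSet := by rw [hbase]; exact hsrc y hy.1.1
      have hy1 := hsrc y hy.1.1
      apply (hinv y hy.1.1).injective
      have e1 : mfderiv (𝓡 m) (𝓡 m) c (π y) (e.localFrame β d (π y)) =
          (EuclideanSpace.single d 1 : EuclideanSpace ℝ (Fin m)) := by
        rw [hc, ← TangentBundle.continuousLinearMapAt_trivializationAt hy1,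
          e.localFrame_apply_of_mem_baseSet β hyb]
        change e.continuousLinearMapAt ℝ (π y) (e.symm (π y) (β d)) = _
        rw [e.continuousLinearMapAt_apply ℝ, e.linearMapAt_apply, if_pos hyb, e.apply_mk_symm hyb]
        simp [β]
      rw [e1]
      refine PiLp.ext (p := 2) (x := (show EuclideanSpace ℝ (Fin m) from _))
          (y := (EuclideanSpace.single d 1 : EuclideanSpace ℝ (Fin m))) fun k => ?_
      have := hHu k d y hy.1
      rw [← hy.2 d, hdu y hy.1.1] at this
      refine this.trans ?_
      simp [Matrix.one_apply]
    -- The inner product is G ∘ π, so its derivative along v factors through dπ v = 0.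
    let G : B → ℝ := fun b' => gB.inner b' (e.localFrame β a b') (e.localFrame β b b')
    have hG : ContMDiffOn (𝓡 m) 𝓘(ℝ, ℝ) ∞ G e.baseSet :=
      contMDiff_baseInner gB (b := fun b' => b') (e.contMDiffOn_localFrame_baseSet ∞ β a)
        (e.contMDiffOn_localFrame_baseSet ∞ β b)
    have hxb : π x ∈ e.baseSet := by rw [hbase]; exact hsrc x (interior_subset hx).1.1
    have heq : (fun y => gB.inner (π y) (mfderiv (𝓡 n) (𝓡 m) π y (F a y))
        (mfderiv (𝓡 n) (𝓡 m) π y (F b y))) =ᶠ[𝓝 x] G ∘ π := by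
      filter_upwards [isOpen_interior.mem_nhds hx] with y hy
      rw [hproj y hy a, hproj y hy b]
      rfl
    have d1 : MDifferentiableAt (𝓡 m) 𝓘(ℝ, ℝ) G (π x) :=
      ((hG _ hxb).contMDiffAt (e.open_baseSet.mem_nhds hxb)).mdifferentiableAt (by simp)
    have d2 : MDifferentiableAt (𝓡 n) (𝓡 m) π x := hπ.1.mdifferentiable (by simp) x
    have key : mfderiv (𝓡 n) 𝓘(ℝ, ℝ) (fun y => gB.inner (π y) (mfderiv (𝓡 n) (𝓡 m) π y (F a y))
        (mfderiv (𝓡 n) (𝓡 m) π y (F b y))) x v = 0 := by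
      rw [heq.mfderiv_eq, mfderiv_comp x d1 d2]
      change mfderiv (𝓡 m) 𝓘(ℝ, ℝ) G (π x) (mfderiv (𝓡 n) (𝓡 m) π x v) = 0
      rw [hv, map_zero]
    exact key

end AdaptedFrame

/-! ### The Koszul formula, powers of r, and the conjugate connection -/

section Koszul

/-- The algebra behind the decomposition of the Koszul formula of an edge metric, in a frame of
vertical (`t = 1`) and horizontal (`t = 0`) vector fields, into a regular model part and a
remainder. -/
theorem koszul_split {r : ℝ} (hr : r ≠ 0) (j : ℕ) {tX tY tZ : ℕ} (hX : tX = 0 ∨ tX = 1)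
    (hY : tY = 0 ∨ tY = 1) (hZ : tZ = 0 ∨ tZ = 1)
    {cX cY cZ hYZ hXZ hXY aYZ aXZ aXY dXh dYh dZh dXa dYa dZa
      bXYh bXZh bYZh bXYa bXZa bYZa G₁ G₂ G₃ B₁ B₂ B₃ K P : ℝ}
    (cX0 : tX = 1 → cX = 0) (cY0 : tY = 1 → cY = 0) (cZ0 : tZ = 1 → cZ = 0)
    (oYZ : tY ≠ tZ → hYZ = 0 ∧ dXh = 0) (oXZ : tX ≠ tZ → hXZ = 0 ∧ dYh = 0)
    (oXY : tX ≠ tY → hXY = 0 ∧ dZh = 0)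
    (vY : tX = 0 → tZ = 0 → tY = 1 → dYh = 0) (vZ : tX = 0 → tY = 0 → tZ = 1 → dZh = 0)
    (nZ : tZ = 0 → bXYh = 0) (nY : tY = 0 → bXZh = 0) (nX : tX = 0 → bYZh = 0)
    (e₁ : r * G₁ = r ^ (tY + tZ) * (r * dXh + (tY + tZ : ℕ) * cX * hYZ) +
      r ^ (tY + tZ + (j + 1)) * (r * dXa + (tY + tZ + (j + 1) : ℕ) * cX * aYZ))
    (e₂ : r * G₂ = r ^ (tX + tZ) * (r * dYh + (tX + tZ : ℕ) * cY * hXZ) +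
      r ^ (tX + tZ + (j + 1)) * (r * dYa + (tX + tZ + (j + 1) : ℕ) * cY * aXZ))
    (e₃ : r * G₃ = r ^ (tX + tY) * (r * dZh + (tX + tY : ℕ) * cZ * hXY) +
      r ^ (tX + tY + (j + 1)) * (r * dZa + (tX + tY + (j + 1) : ℕ) * cZ * aXY))
    (f₁ : B₁ = r ^ (1 + tZ) * (bXYh + r ^ (j + 1) * bXYa))
    (f₂ : B₂ = r ^ (1 + tY) * (bXZh + r ^ (j + 1) * bXZa))
    (f₃ : B₃ = r ^ (1 + tX) * (bYZh + r ^ (j + 1) * bYZa))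
    (hK : 2 * (r ^ tY * K + tY * cX * r ^ tZ * (hYZ + r ^ (j + 1) * aYZ)) =
      G₁ + G₂ - G₃ + B₁ - B₂ - B₃)
    (hP : r ^ tZ * P = K) :
    2 * P = (dXh + (if tX = 0 then (1 - tY) * dYh - (1 - tZ) * dZh
        else r ^ (1 - tY) * dYh - r ^ (1 - tZ) * dZh)
      + (r ^ (1 - tY) * bXYh - r ^ (1 - tZ) * bXZh
      + (if tX = 0 then 0 else (1 + tZ) * cY * hXZ - (1 + tY) * cZ * hXY
        - r ^ (2 - tY - tZ) * bYZh)))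
      + r ^ j * (r ^ tX * ((r ^ (1 - tX) * dXa + (j + 1 : ℕ) * cX * aYZ)
        + (r ^ (1 - tY) * dYa + (j + 1 : ℕ) * cY * aXZ)
        - (r ^ (1 - tZ) * dZa + (j + 1 : ℕ) * cZ * aXY)
        + (r ^ (2 - tX - tY) * bXYa - cX * tY * aYZ + cY * tX * aXZ)
        - (r ^ (2 - tX - tZ) * bXZa - cX * tZ * aYZ + cZ * tX * aXY)
        - (r ^ (2 - tY - tZ) * bYZa - cY * tZ * aXZ + cZ * tY * aXY))) := by
  -- In the intended use, t and c are the weight and the radial component of a field; the suffixes h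
  -- and a refer to h^φ and α; d is a derivative of a pairing and b a pairing with a bracket. G₁,
  -- G₂, G₃, B₁, B₂, B₃ are the Koszul terms for g, K = g(∇_X(φ⁻¹Y), Z) and P is the pairing sought.
  -- In `hK` the coefficient of P is 2 r^(tY + tZ), and the extra factor r is the one carried by
  -- `e₁`, `e₂`, `e₃`. As all weights are at most 1, no subtraction in an exponent is truncated.
  apply mul_left_cancel₀ (pow_ne_zero (1 + tY + tZ) hr)
  subst f₁ f₂ f₃ hP
  -- In each of the eight weight patterns the applicable vanishing hypotheses remove the singular
  -- h-terms, and what remains is polynomial.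
  rcases hX with rfl | rfl <;> rcases hY with rfl | rfl <;> rcases hZ with rfl | rfl <;>
  simp only [forall_true_left, ne_eq, not_true_eq_false, IsEmpty.forall_iff, zero_ne_one,
    one_ne_zero, not_false_eq_true] at cX0 cY0 cZ0 oYZ oXZ oXY vY vZ nZ nY nX <;>
  push_cast at e₁ e₂ e₃ hK ⊢ <;>
  simp only [*] at e₁ e₂ e₃ hK ⊢ <;>
  linear_combination r * hK + e₁ + e₂ - e₃

variable {n m : ℕ} {N : Type u} [TopologicalSpace N] [ChartedSpace (EuclideanSpace ℝ (Fin n)) N]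
  [IsManifold (𝓡 n) ∞ N]
  {B : Type w} [TopologicalSpace B] [ChartedSpace (EuclideanSpace ℝ (Fin m)) B]
  [IsManifold (𝓡 m) ∞ B] {π : N → B} {ε : ℝ} {X Y Z : VField n N} {g : FormField n N}
  {D : ConnOp n N} {O : Set N}

/-- The Koszul formula. -/
theorem IsLeviCivitaOn.koszul (hD : IsLeviCivitaOn (openCollar N ε) g D)
    (hsymm : ∀ p ∈ openCollar N ε, ∀ v v' : TangentSpace (cylModel n) p, g p v v' = g p v' v)
    (hX : SmoothFieldOn (collar N ε) X) (hY : SmoothFieldOn (collar N ε) Y)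
    (hZ : SmoothFieldOn (collar N ε) Z) {p : ℝ × N} (hp : p ∈ openCollar N ε) :
    2 * g p (D Y p (X p)) (Z p) =
      dirDeriv n ε (fun q => g q (Y q) (Z q)) X p + dirDeriv n ε (fun q => g q (X q) (Z q)) Y p
      - dirDeriv n ε (fun q => g q (X q) (Y q)) Z p
      + g p (mlieBracketWithin (cylModel n) X Y (collar N ε) p) (Z p)
      - g p (mlieBracketWithin (cylModel n) X Z (collar N ε) p) (Y p)
      - g p (mlieBracketWithin (cylModel n) Y Z (collar N ε) p) (X p) := by
  have hX' := hX.mono openCollar_subset_collar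
  have hY' := hY.mono openCollar_subset_collar
  have hZ' := hZ.mono openCollar_subset_collar
  unfold dirDeriv
  rw [← mvfderivWithin_openCollar _ hp, ← mvfderivWithin_openCollar _ hp,
    ← mvfderivWithin_openCollar _ hp, ← mlieBracketWithin_openCollar _ _ hp,
    ← mlieBracketWithin_openCollar _ _ hp, ← mlieBracketWithin_openCollar _ _ hp,
    hD.metric Y Z hY' hZ' p hp, hD.metric X Z hX' hZ' p hp, hD.metric X Y hX' hY' p hp,
    ← hD.torsionFree X Y hX' hY' p hp, ← hD.torsionFree X Z hX' hZ' p hp,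
    ← hD.torsionFree Y Z hY' hZ' p hp]
  simp only [map_sub, sub_apply]
  rw [hsymm p hp (D Z p (X p)) (Y p), hsymm p hp (D X p (Z p)) (Y p),
    hsymm p hp (D Y p (Z p)) (X p), hsymm p hp (D Z p (Y p)) (X p)]
  ring

/-- A connection on an open part of the cylinder is a local operator. -/
theorem IsConnectionOn.congr_of_eqOn [T2Space N] {s : Set (ℝ × N)} (hD : IsConnectionOn s D)
    {Y' : VField n N} (hY : SmoothFieldOn s Y)
    (hY' : SmoothFieldOn s Y') (hO : IsOpen O) (h : ∀ q ∈ s, q.2 ∈ O → Y q = Y' q) {p : ℝ × N}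
    (hp : p ∈ s) (hpO : p.2 ∈ O) : D Y p = D Y' p := by
  classical
  obtain ⟨ψ, h1, h2, h3⟩ := exists_bump (n := n) (hO.mem_nhds hpO)
  -- `D` is constrained only through fields smooth on `s` but takes fields on all of ℝ × N. The
  -- indicator makes f • Y and f • Y' equal everywhere, not merely on `s`.
  set f : ℝ × N → ℝ := s.indicator (fun q => ψ q.2) with hf
  have hfs : SmoothFunOn n s f :=
    (smoothFunOn_snd h1).congr fun q hq => indicator_of_mem hq _
  have hf1 : f =ᶠ[𝓝[s] p] fun _ => 1 := by
    have : ∀ᶠ q in 𝓝[s] p, ψ q.2 = 1 :=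
      nhdsWithin_le_nhds (continuous_snd.continuousAt.eventually h3)
    filter_upwards [this, self_mem_nhdsWithin] with q hq hqs
    rw [hf, indicator_of_mem hqs, hq]
  have hfp : f p = 1 := by
    rw [hf, indicator_of_mem hp]; exact h3.self_of_nhds
  have hd : mvfderivWithin (cylModel n) f s p = 0 := by
    rw [← mvfderivWithin_const (I := cylModel n) (s := s) (1 : ℝ)]
    unfold mvfderivWithin
    ext v
    exact congrArg (fun T : TangentSpace (cylModel n) p →L[ℝ] ℝ => T v)
      (hf1.mfderivWithin_eq (I := cylModel n) (I' := 𝓘(ℝ, ℝ)) hfp)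
  have heq : (fun q => f q • Y q) = fun q => f q • Y' q := by
    funext q
    by_cases hq : q ∈ s
    · by_cases hqO : q.2 ∈ O
      · rw [h q hq hqO]
      · have : f q = 0 := by
          rw [hf, indicator_of_mem hq]
          exact image_eq_zero_of_notMem_tsupport fun hc => hqO (h2 hc)
        rw [this, zero_smul, zero_smul]
    · have : f q = 0 := indicator_of_notMem hq _
      rw [this, zero_smul, zero_smul]
  ext v
  have e1 := hD.leibniz f Y hfs hY p hp v
  have e2 := hD.leibniz f Y' hfs hY' p hp v
  rw [heq, e2, hd, hfp] at e1
  simpa using e1.symm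

/-- The extra factor r on both sides avoids the exponent i - 1, so that i = 0 is not exceptional. -/
theorem dirDeriv_pow_mul {f : ℝ × N → ℝ} (hf : SmoothFunOn n (collar N ε) f) (i : ℕ) {p : ℝ × N}
    (hp : p ∈ collar N ε) :
    p.1 * dirDeriv n ε (fun q => q.1 ^ i * f q) X p =
      p.1 ^ i * (p.1 * dirDeriv n ε f X p + i * dr p (X p) * f p) := by
  have hpow : ∀ i : ℕ, SmoothFunOn n (collar N ε) (fun q : ℝ × N => q.1 ^ i) := fun i =>
    smoothFunOn_fst.pow i
  have key : ∀ i : ℕ, p.1 * dirDeriv n ε (fun q => q.1 ^ i) X p = p.1 ^ i * (i * dr p (X p)) := by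
    intro i
    induction i with
    | zero => simp [dirDeriv_const]
    | succ i ih =>
      have : (fun q : ℝ × N => q.1 ^ (i + 1)) = fun q => q.1 ^ i * q.1 := by
        funext q; rw [pow_succ]
      rw [this, dirDeriv_mul (hpow i) smoothFunOn_fst hp, dirDeriv_fst hp]
      push_cast
      linear_combination p.1 * ih
  rw [dirDeriv_mul (hpow i) hf hp]
  linear_combination f p * key i

/-- The operator `φ ∇ φ⁻¹`. -/
def conj (𝓔 : EhresmannConnection n m π) (D : ConnOp n N) (Y : VField n N) (p : ℝ × N) :
    TangentSpace (cylModel n) p →L[ℝ] TangentSpace (cylModel n) p :=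
  (phi 𝓔 p).comp (D (fun q => phiInv 𝓔 q (Y q)) p)

theorem conj_apply (𝓔 : EhresmannConnection n m π) (D : ConnOp n N) (Y : VField n N) (p : ℝ × N)
    (v : TangentSpace (cylModel n) p) :
    conj 𝓔 D Y p v = phi 𝓔 p (D (fun q => phiInv 𝓔 q (Y q)) p v) := rfl

variable {𝓔 : EhresmannConnection n m π}

theorem conj_add (hD : IsConnectionOn (openCollar N ε) D) (hX : SmoothFieldOn (collar N ε) X)
    (hY : SmoothFieldOn (collar N ε) Y) {p : ℝ × N} (hp : p ∈ openCollar N ε) :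
    conj 𝓔 D (fun q => X q + Y q) p = conj 𝓔 D X p + conj 𝓔 D Y p := by
  have h := hD.add _ _ (hX.phiInv 𝓔) (hY.phiInv 𝓔) p hp
  ext v
  rw [add_apply, conj_apply, conj_apply, conj_apply]
  simp only [map_add]
  rw [h, add_apply, map_add]

theorem conj_smul (hD : IsConnectionOn (openCollar N ε) D) {f : ℝ × N → ℝ}
    (hf : SmoothFunOn n (collar N ε) f)
    (hY : SmoothFieldOn (collar N ε) Y) {p : ℝ × N} (hp : p ∈ openCollar N ε)
    (v : TangentSpace (cylModel n) p) :
    conj 𝓔 D (fun q => f q • Y q) p v =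
      f p • conj 𝓔 D Y p v + mvfderivWithin (cylModel n) f (collar N ε) p v • Y p := by
  have h := hD.leibniz f _ (hf.mono openCollar_subset_collar) (hY.phiInv 𝓔) p hp v
  rw [conj_apply, conj_apply]
  simp only [map_smul]
  rw [h, map_add, map_smul, map_smul, (phi_phiInv 𝓔 p (fst_ne_zero_of_mem hp) (Y p)).1,
    mvfderivWithin_openCollar _ hp]

theorem conj_congr [T2Space N] (hD : IsConnectionOn (openCollar N ε) D)
    (hX : SmoothFieldOn (collar N ε) X) (hY : SmoothFieldOn (collar N ε) Y) (hO : IsOpen O)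
    (h : ∀ q ∈ collar N ε, q.2 ∈ O → X q = Y q) {p : ℝ × N} (hp : p ∈ openCollar N ε)
    (hpO : p.2 ∈ O) : conj 𝓔 D X p = conj 𝓔 D Y p := by
  unfold EdgeMetric.conj
  rw [hD.congr_of_eqOn (hX.phiInv 𝓔) (hY.phiInv 𝓔) hO
    (fun q hq hqO => by rw [h q (openCollar_subset_collar hq) hqO]) hp hpO]

end Koszul

/-! ### Adapted vector fields: brackets and inner products -/

section AdaptedFields

variable {n m : ℕ} {N : Type u} [TopologicalSpace N] [ChartedSpace (EuclideanSpace ℝ (Fin n)) N]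
  [IsManifold (𝓡 n) ∞ N]
  {B : Type w} [TopologicalSpace B] [ChartedSpace (EuclideanSpace ℝ (Fin m)) B]
  [IsManifold (𝓡 m) ∞ B] {π : N → B} {ε : ℝ} {X Y Z : VField n N} {g : FormField n N}
  {D : ConnOp n N} {O : Set N} {𝓔 : EhresmannConnection n m π} {gB : BaseMetric m B}
  {gV : VerticalMetric n m π ε}

/-- Over `O`, the vector field `X` is vertical (`t = 1`), or a constant multiple of `∂_r` plus
possibly a horizontal field of the adapted frame (`t = 0`); its radial component is `c`. -/
structure IsAdapted (A : AdaptedFrame 𝓔 gB O) (ε : ℝ) (t : ℕ) (c : ℝ) (X : VField n N) :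
    Prop where
  smooth : SmoothFieldOn (collar N ε) X
  zero_or_one : t = 0 ∨ t = 1
  dr_eq : ∀ p ∈ collar N ε, p.2 ∈ O → dr p (X p) = c
  coeff_eq_zero : t = 1 → c = 0
  vertProj_eq : t = 1 → ∀ p ∈ collar N ε, p.2 ∈ O → vertProj 𝓔 p (X p) = X p
  toN_eq : t = 0 → (∀ p ∈ collar N ε, p.2 ∈ O → toN p (X p) = 0) ∨
    ∃ a, ∀ p ∈ collar N ε, p.2 ∈ O → toN p (X p) = A.field a p.2

theorem dr_vertProj (p : ℝ × N) (v : TangentSpace (cylModel n) p) : dr p (vertProj 𝓔 p v) = 0 := rfl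

theorem mfderiv_toN_vertProj (p : ℝ × N) (v : TangentSpace (cylModel n) p) :
    mfderiv (𝓡 n) (𝓡 m) π p.2 (toN p (vertProj 𝓔 p v)) = 0 := 𝓔.vertical p.2 (toN p v)

theorem vertProj_eq_self {p : ℝ × N} {v : TangentSpace (cylModel n) p} (h : dr p v = 0)
    (h' : mfderiv (𝓡 n) (𝓡 m) π p.2 (toN p v) = 0) : vertProj 𝓔 p v = v := by
  have h1 := 𝓔.proj_eq_self p.2 _ h'
  refine Prod.ext ?_ ?_
  · exact h.symm
  · exact h1

variable {A : AdaptedFrame 𝓔 gB O} {t t' t'' : ℕ} {c c' c'' : ℝ}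

theorem AdaptedFrame.vertProj_eq_self (A : AdaptedFrame 𝓔 gB O) {p : ℝ × N} (hpO : p.2 ∈ O)
    {v : TangentSpace (cylModel n) p} (h : dr p v = 0)
    (h' : ∀ a, mvfderiv (𝓡 n) (A.coord a) p.2 (toN p v) = 0) : vertProj 𝓔 p v = v :=
  EdgeMetric.vertProj_eq_self h ((A.vertical_iff p.2 hpO _).2 h')

theorem IsAdapted.vertProj_eq_zero (hX : IsAdapted A ε t c X) (ht : t = 0) {p : ℝ × N}
    (hp : p ∈ collar N ε) (hpO : p.2 ∈ O) : vertProj 𝓔 p (X p) = 0 := by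
  change fromN p (𝓔.proj p.2 (toN p (X p))) = 0
  rcases hX.toN_eq ht with h | ⟨a, h⟩
  · rw [h p hp hpO, map_zero, map_zero]
  · rw [h p hp hpO, A.proj_field a p.2 hpO, map_zero]

theorem IsAdapted.vertScale_eq (hX : IsAdapted A ε t c X) (d : ℝ) {p : ℝ × N}
    (hp : p ∈ collar N ε) (hpO : p.2 ∈ O) : vertScale 𝓔 d p (X p) = d ^ t • X p := by
  rw [vertScale_apply]
  rcases hX.zero_or_one with h | h
  · rw [hX.vertProj_eq_zero h hp hpO, h]
    simp
  · rw [hX.vertProj_eq h p hp hpO, h]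
    simp

theorem IsAdapted.exists_coord_deriv (hX : IsAdapted A ε t c X) (a : Fin m) :
    ∃ d : ℝ, ∀ p ∈ collar N ε, p.2 ∈ O → dirDeriv n ε (fun q => A.coord a q.2) X p = d := by
  rcases hX.zero_or_one with h | h
  · rcases hX.toN_eq h with h | ⟨b, h⟩
    · refine ⟨0, fun p hp hpO => ?_⟩
      rw [dirDeriv_snd (A.contMDiff_coord a) hp, h p hp hpO, map_zero]
    · refine ⟨(1 : Matrix (Fin m) (Fin m) ℝ) a b, fun p hp hpO => ?_⟩
      rw [dirDeriv_snd (A.contMDiff_coord a) hp, h p hp hpO, A.mvfderiv_coord_field a b p.2 hpO]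
  · refine ⟨0, fun p hp hpO => ?_⟩
    rw [dirDeriv_snd (A.contMDiff_coord a) hp, ← hX.vertProj_eq h p hp hpO]
    exact (A.vertical_iff p.2 hpO _).1 (mfderiv_toN_vertProj p _) a

theorem AdaptedFrame.mem_nhds (A : AdaptedFrame 𝓔 gB O) {p : ℝ × N} (hp : p ∈ openCollar N ε)
    (hpO : p.2 ∈ O) : {q : ℝ × N | q ∈ openCollar N ε ∧ q.2 ∈ O} ∈ 𝓝 p :=
  inter_mem (isOpen_openCollar.mem_nhds hp) (continuous_snd.continuousAt (A.isOpen.mem_nhds hpO))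

theorem AdaptedFrame.dirDeriv_congr (A : AdaptedFrame 𝓔 gB O) {f f' : ℝ × N → ℝ}
    (h : ∀ q ∈ openCollar N ε, q.2 ∈ O → f q = f' q) {p : ℝ × N} (hp : p ∈ openCollar N ε)
    (hpO : p.2 ∈ O) : dirDeriv n ε f X p = dirDeriv n ε f' X p :=
  EdgeMetric.dirDeriv_congr (mem_of_superset (A.mem_nhds hp hpO) fun q hq => h q hq.1 hq.2)

theorem IsAdapted.dirDeriv_bracket_eq_zero (hX : IsAdapted A ε t c X) (hY : IsAdapted A ε t' c' Y)
    {f : ℝ × N → ℝ} (hf : SmoothFunOn n (collar N ε) f) {d d' : ℝ}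
    (hd : ∀ q ∈ collar N ε, q.2 ∈ O → dirDeriv n ε f X q = d)
    (hd' : ∀ q ∈ collar N ε, q.2 ∈ O → dirDeriv n ε f Y q = d') {p : ℝ × N}
    (hp : p ∈ openCollar N ε) (hpO : p.2 ∈ O) :
    dirDeriv n ε f (mlieBracketWithin (cylModel n) X Y (collar N ε)) p = 0 := by
  rw [dirDeriv_bracket hX.smooth hY.smooth hf hp,
    A.dirDeriv_congr (f' := fun _ => d') (fun q hq => hd' q (openCollar_subset_collar hq)) hp hpO,
    A.dirDeriv_congr (f' := fun _ => d) (fun q hq => hd q (openCollar_subset_collar hq)) hp hpO,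
    dirDeriv_const, dirDeriv_const, sub_zero]

/-- The functions r and u_a (the pulled-back coordinates) have constant derivatives along adapted
fields over `O`, hence zero derivative along their brackets; a vector killed by dr and all du_a is
vertical. -/
theorem IsAdapted.vertProj_bracket (hX : IsAdapted A ε t c X) (hY : IsAdapted A ε t' c' Y)
    {p : ℝ × N} (hp : p ∈ openCollar N ε) (hpO : p.2 ∈ O) :
    vertProj 𝓔 p (mlieBracketWithin (cylModel n) X Y (collar N ε) p) =
      mlieBracketWithin (cylModel n) X Y (collar N ε) p := by
  have hpc := openCollar_subset_collar hp
  refine A.vertProj_eq_self hpO ?_ fun a => ?_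
  · rw [← dirDeriv_fst (X := mlieBracketWithin (cylModel n) X Y (collar N ε)) hpc]
    exact hX.dirDeriv_bracket_eq_zero hY smoothFunOn_fst
      (fun q hq hqO => (dirDeriv_fst hq).trans (hX.dr_eq q hq hqO))
      (fun q hq hqO => (dirDeriv_fst hq).trans (hY.dr_eq q hq hqO)) hp hpO
  · obtain ⟨d, hd⟩ := hX.exists_coord_deriv a
    obtain ⟨d', hd'⟩ := hY.exists_coord_deriv a
    rw [← dirDeriv_snd (X := mlieBracketWithin (cylModel n) X Y (collar N ε))
      (A.contMDiff_coord a) hpc]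
    exact hX.dirDeriv_bracket_eq_zero hY (smoothFunOn_snd (A.contMDiff_coord a)) hd hd' hp hpO

theorem modelMetricPhi_apply (p : ℝ × N) (v v' : TangentSpace (cylModel n) p) :
    modelMetricPhi 𝓔 gV gB p v v' =
      dr p v * dr p v' + gV.form p (vertProj 𝓔 p v) (vertProj 𝓔 p v')
        + gB.inner (π p.2) (mfderiv (𝓡 n) (𝓡 m) π p.2 (toN p v))
            (mfderiv (𝓡 n) (𝓡 m) π p.2 (toN p v')) := by
  rw [modelMetricPhi, scaledForm_apply, one_pow, one_mul]

theorem modelMetricPhi_vertical_left {p : ℝ × N} {v v' : TangentSpace (cylModel n) p}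
    (h : vertProj 𝓔 p v = v) (h' : vertProj 𝓔 p v' = 0) :
    modelMetricPhi 𝓔 gV gB p v v' = 0 := by
  rw [modelMetricPhi_apply, h', ← h, dr_vertProj, mfderiv_toN_vertProj]
  simp

theorem modelMetricPhi_vertical_right {p : ℝ × N} {v v' : TangentSpace (cylModel n) p}
    (h : vertProj 𝓔 p v = 0) (h' : vertProj 𝓔 p v' = v') :
    modelMetricPhi 𝓔 gV gB p v v' = 0 := by
  rw [modelMetricPhi_apply, h, ← h', dr_vertProj, mfderiv_toN_vertProj]
  simp

theorem IsAdapted.modelMetricPhi_eq_zero (gV : VerticalMetric n m π ε)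
    (hX : IsAdapted A ε t c X) (hY : IsAdapted A ε t' c' Y)
    (h : t ≠ t') {p : ℝ × N} (hp : p ∈ collar N ε) (hpO : p.2 ∈ O) :
    modelMetricPhi 𝓔 gV gB p (X p) (Y p) = 0 := by
  rcases hX.zero_or_one with h1 | h1 <;> rcases hY.zero_or_one with h2 | h2
  · omega
  · exact modelMetricPhi_vertical_right (hX.vertProj_eq_zero h1 hp hpO) (hY.vertProj_eq h2 p hp hpO)
  · exact modelMetricPhi_vertical_left (hX.vertProj_eq h1 p hp hpO) (hY.vertProj_eq_zero h2 hp hpO)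
  · omega

theorem IsAdapted.dirDeriv_modelMetricPhi_eq_zero (gV : VerticalMetric n m π ε)
    (hX : IsAdapted A ε t c X)
    (hY : IsAdapted A ε t' c' Y) (h : t ≠ t') {p : ℝ × N} (hp : p ∈ openCollar N ε)
    (hpO : p.2 ∈ O) :
    dirDeriv n ε (fun q => modelMetricPhi 𝓔 gV gB q (X q) (Y q)) Z p = 0 := by
  rw [A.dirDeriv_congr (f' := fun _ => 0) (fun q hq hqO =>
    hX.modelMetricPhi_eq_zero gV hY h (openCollar_subset_collar hq) hqO) hp hpO, dirDeriv_const]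

theorem contMDiff_frame_inner (hπ : ContMDiff (𝓡 n) (𝓡 m) ∞ π) (A : AdaptedFrame 𝓔 gB O)
    (a b : Fin m) : ContMDiff (𝓡 n) 𝓘(ℝ, ℝ) ∞ (fun y => gB.inner (π y)
      (mfderiv (𝓡 n) (𝓡 m) π y (A.field a y)) (mfderiv (𝓡 n) (𝓡 m) π y (A.field b y))) := by
  have h : ∀ a, ContMDiff (𝓡 n) (𝓡 m).tangent ∞ (fun y =>
      (⟨π y, mfderiv (𝓡 n) (𝓡 m) π y (A.field a y)⟩ : TangentBundle (𝓡 m) B)) := fun a =>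
    (hπ.contMDiff_tangentMap (m := ∞) (by simp)).comp (A.contMDiff_field a)
  exact contMDiffOn_univ.1 (contMDiff_baseInner gB (h a).contMDiffOn (h b).contMDiffOn)

/-- The pairing is a constant plus an inner product that either vanishes or is pulled back from B.
This is where the horizontal part of the model being π^*g^B, independent of r and of the fiber,
enters: otherwise the Koszul formula would contain a term of order r⁻¹. -/
theorem IsAdapted.dirDeriv_modelMetricPhi_horizontal (hπ : ContMDiff (𝓡 n) (𝓡 m) ∞ π)
    (gV : VerticalMetric n m π ε) (hX : IsAdapted A ε t c X)
    (hY : IsAdapted A ε t' c' Y) (hZ : IsAdapted A ε t'' c'' Z) (h : t = 0) (h' : t' = 0)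
    (h'' : t'' = 1) {p : ℝ × N} (hp : p ∈ openCollar N ε) (hpO : p.2 ∈ O) :
    dirDeriv n ε (fun q => modelMetricPhi 𝓔 gV gB q (X q) (Y q)) Z p = 0 := by
  have hform : ∀ q ∈ openCollar N ε, q.2 ∈ O → modelMetricPhi 𝓔 gV gB q (X q) (Y q) =
      c * c' + gB.inner (π q.2) (mfderiv (𝓡 n) (𝓡 m) π q.2 (toN q (X q)))
            (mfderiv (𝓡 n) (𝓡 m) π q.2 (toN q (Y q))) := by
    intro q hq hqO
    have hq := openCollar_subset_collar hq
    rw [modelMetricPhi_apply, hX.dr_eq q hq hqO, hY.dr_eq q hq hqO, hX.vertProj_eq_zero h hq hqO]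
    simp
  have hv : mfderiv (𝓡 n) (𝓡 m) π p.2 (toN p (Z p)) = 0 := by
    rw [← hZ.vertProj_eq h'' p (openCollar_subset_collar hp) hpO, mfderiv_toN_vertProj]
  have hconst : (∀ q ∈ openCollar N ε, q.2 ∈ O →
      gB.inner (π q.2) (mfderiv (𝓡 n) (𝓡 m) π q.2 (toN q (X q)))
            (mfderiv (𝓡 n) (𝓡 m) π q.2 (toN q (Y q))) = 0) →
      dirDeriv n ε (fun q => modelMetricPhi 𝓔 gV gB q (X q) (Y q)) Z p = 0 := by
    intro h0
    rw [A.dirDeriv_congr (f' := fun _ => c * c') (fun q hq hqO => by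
      rw [hform q hq hqO, h0 q hq hqO, add_zero]) hp hpO, dirDeriv_const]
  rcases hX.toN_eq h with hX0 | ⟨a, ha⟩
  · refine hconst fun q hq hqO => ?_
    rw [hX0 q (openCollar_subset_collar hq) hqO]
    simp
  rcases hY.toN_eq h' with hY0 | ⟨b, hb⟩
  · refine hconst fun q hq hqO => ?_
    rw [hY0 q (openCollar_subset_collar hq) hqO]
    simp
  have hin := contMDiff_frame_inner hπ A a b
  rw [A.dirDeriv_congr (f' := fun q => c * c' + (fun y => gB.inner (π y)
      (mfderiv (𝓡 n) (𝓡 m) π y (A.field a y)) (mfderiv (𝓡 n) (𝓡 m) π y (A.field b y))) q.2)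
      (fun q hq hqO => by
        rw [hform q hq hqO, ha q (openCollar_subset_collar hq) hqO,
          hb q (openCollar_subset_collar hq) hqO]) hp hpO,
    dirDeriv_add contMDiffOn_const (smoothFunOn_snd hin) (openCollar_subset_collar hp),
    dirDeriv_const, dirDeriv_snd hin (openCollar_subset_collar hp),
    A.mvfderiv_inner a b p.2 hpO _ hv, zero_add]

end AdaptedFields

/-! ### Pairings of the conjugate connection on adapted fields -/

section Pairing

variable {n m : ℕ} {N : Type u} [TopologicalSpace N] [ChartedSpace (EuclideanSpace ℝ (Fin n)) N]
  [IsManifold (𝓡 n) ∞ N]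
  {B : Type w} [TopologicalSpace B] [ChartedSpace (EuclideanSpace ℝ (Fin m)) B]
  [IsManifold (𝓡 m) ∞ B] {π : N → B} {ε : ℝ} {X Y Z : VField n N} {g : FormField n N}
  {D : ConnOp n N} {O : Set N} {𝓔 : EhresmannConnection n m π} {gB : BaseMetric m B}
  {gV : VerticalMetric n m π ε} {A : AdaptedFrame 𝓔 gB O} {t t' t'' : ℕ} {c c' c'' : ℝ}
  {s : Set (ℝ × N)} {f f' : ℝ × N → ℝ} {α : FormField n N} {j : ℕ}

theorem SmoothFunOn.add (hf : SmoothFunOn n s f) (hf' : SmoothFunOn n s f') :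
    SmoothFunOn n s (fun p => f p + f' p) := ContMDiffOn.add hf hf'

theorem SmoothFunOn.sub (hf : SmoothFunOn n s f) (hf' : SmoothFunOn n s f') :
    SmoothFunOn n s (fun p => f p - f' p) := ContMDiffOn.sub hf hf'

theorem SmoothFunOn.mul (hf : SmoothFunOn n s f) (hf' : SmoothFunOn n s f') :
    SmoothFunOn n s (fun p => f p * f' p) := ContMDiffOn.mul hf hf'

theorem smoothFunOn_const (c : ℝ) : SmoothFunOn n s (fun _ => c) := contMDiffOn_const

theorem smoothFunOn_fst_pow (i : ℕ) : SmoothFunOn n s (fun p => p.1 ^ i) := smoothFunOn_fst.pow i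

theorem mvfderivWithin_fst {p : ℝ × N} (hp : p ∈ collar N ε) (v : TangentSpace (cylModel n) p) :
    mvfderivWithin (cylModel n) Prod.fst (collar N ε) p v = dr p v := by
  unfold mvfderivWithin
  rw [mfderivWithin_fst (I := 𝓘(ℝ, ℝ)) (I' := 𝓡 n) (uniqueMDiffWithinAt_collar hp)]
  rfl

/-- `φ⁻¹ X = r⁻¹ X` for `X` vertical, and `φ⁻¹ X = X` for `X` horizontal; the effect on a
connection. -/
theorem IsAdapted.conn_apply [T2Space N] (hD : IsConnectionOn (openCollar N ε) D)
    (hY : IsAdapted A ε t c Y) {p : ℝ × N} (hp : p ∈ openCollar N ε) (hpO : p.2 ∈ O)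
    (v : TangentSpace (cylModel n) p) :
    D Y p v = p.1 ^ t • D (fun q => phiInv 𝓔 q (Y q)) p v + (t * dr p v) • phiInv 𝓔 p (Y p) := by
  have hY' := hY.smooth.phiInv 𝓔
  have hY₀ := hY.smooth.mono openCollar_subset_collar
  rcases hY.zero_or_one with h | h
  · rw [hD.congr_of_eqOn hY₀ hY' A.isOpen (fun q hq hqO => ?_) hp hpO, h]
    · simp
    · rw [phiInv, hY.vertScale_eq _ (openCollar_subset_collar hq) hqO, h, pow_zero, one_smul]
  · have h1 := hD.leibniz Prod.fst _ smoothFunOn_fst hY' p hp v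
    rw [mvfderivWithin_openCollar _ hp, mvfderivWithin_fst (openCollar_subset_collar hp)] at h1
    rw [hD.congr_of_eqOn hY₀ (hY'.smul smoothFunOn_fst) A.isOpen (fun q hq hqO => ?_) hp hpO, h1, h]
    · simp
    · rw [phiInv, hY.vertScale_eq _ (openCollar_subset_collar hq) hqO, h, pow_one, smul_smul,
        mul_inv_cancel₀ (fst_ne_zero_of_mem hq), one_smul]

/-- `g (φ⁻¹ ·, φ⁻¹ ·) = h^φ + r ^ k α` for `r ≠ 0`. -/
def PerturbedBy (𝓔 : EhresmannConnection n m π) (gV : VerticalMetric n m π ε)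
    (gB : BaseMetric m B) (k : ℕ) (α g : FormField n N) : Prop :=
  ∀ p ∈ openCollar N ε, ∀ v v' : TangentSpace (cylModel n) p,
    g p (phiInv 𝓔 p v) (phiInv 𝓔 p v') = modelMetricPhi 𝓔 gV gB p v v' + p.1 ^ k * α p v v'

theorem PerturbedBy.apply {k : ℕ} (hg : PerturbedBy 𝓔 gV gB k α g) {p : ℝ × N}
    (hp : p ∈ openCollar N ε) (v v' : TangentSpace (cylModel n) p) :
    g p v v' = modelMetricPhi 𝓔 gV gB p (phi 𝓔 p v) (phi 𝓔 p v')
      + p.1 ^ k * α p (phi 𝓔 p v) (phi 𝓔 p v') := by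
  rw [← hg p hp, (phi_phiInv 𝓔 p (fst_ne_zero_of_mem hp) v).2,
    (phi_phiInv 𝓔 p (fst_ne_zero_of_mem hp) v').2]

theorem PerturbedBy.apply_smul {k i i' : ℕ} (hg : PerturbedBy 𝓔 gV gB k α g) {p : ℝ × N}
    (hp : p ∈ openCollar N ε) {v v' : TangentSpace (cylModel n) p} (hv : phi 𝓔 p v = p.1 ^ i • v)
    (hv' : phi 𝓔 p v' = p.1 ^ i' • v') :
    g p v v' = p.1 ^ (i + i') * (modelMetricPhi 𝓔 gV gB p v v' + p.1 ^ k * α p v v') := by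
  rw [hg.apply hp, hv, hv']
  simp only [map_smul, smul_apply, smul_eq_mul]
  ring

/-- On adapted fields g(Y,Z) is r^(t' + t'') times h^φ(Y,Z) + r^k α(Y,Z), and differentiating a
power of r along X produces the constant radial component c. -/
theorem PerturbedBy.dirDeriv_adapted {k : ℕ} (hπ : ContMDiff (𝓡 n) (𝓡 m) ∞ π)
    (hg : PerturbedBy 𝓔 gV gB k α g) (hα : SmoothFormOn (collar N ε) α)
    (hX : IsAdapted A ε t c X) (hY : IsAdapted A ε t' c' Y) (hZ : IsAdapted A ε t'' c'' Z)
    {p : ℝ × N} (hp : p ∈ openCollar N ε) (hpO : p.2 ∈ O) :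
    p.1 * dirDeriv n ε (fun q => g q (Y q) (Z q)) X p =
      p.1 ^ (t' + t'') * (p.1 * dirDeriv n ε (fun q => modelMetricPhi 𝓔 gV gB q (Y q) (Z q)) X p
        + (t' + t'' : ℕ) * c * modelMetricPhi 𝓔 gV gB p (Y p) (Z p))
      + p.1 ^ (t' + t'' + k) * (p.1 * dirDeriv n ε (fun q => α q (Y q) (Z q)) X p
        + (t' + t'' + k : ℕ) * c * α p (Y p) (Z p)) := by
  have hpc := openCollar_subset_collar hp
  have h1 := smoothFunOn_modelMetricPhi hπ 𝓔 gV gB hY.smooth hZ.smooth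
  have h2 := hα.apply hY.smooth hZ.smooth
  rw [A.dirDeriv_congr (f' := fun q => q.1 ^ (t' + t'') * modelMetricPhi 𝓔 gV gB q (Y q) (Z q)
      + q.1 ^ (t' + t'' + k) * α q (Y q) (Z q)) (fun q hq hqO => ?_) hp hpO,
    dirDeriv_add ((smoothFunOn_fst_pow _).mul h1) ((smoothFunOn_fst_pow _).mul h2) hpc, mul_add,
    dirDeriv_pow_mul h1 _ hpc, dirDeriv_pow_mul h2 _ hpc, hX.dr_eq p hpc hpO]
  have hqc := openCollar_subset_collar hq
  rw [hg.apply_smul hq (hY.vertScale_eq q.1 hqc hqO) (hZ.vertScale_eq q.1 hqc hqO)]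
  ring

/-- The pairings `2 h^φ (φ ∇ φ⁻¹ Y (X), Z)`, over `O`, for the connections `DH` of the model metric
and `DG` of a perturbation of order `j + 1` with tensor `α`, are `M` and `M + r ^ j Q`, with `M` and
`Q` smooth up to the boundary. -/
def HasPairing (𝓔 : EhresmannConnection n m π) (gV : VerticalMetric n m π ε)
    (gB : BaseMetric m B) (O : Set N) (j : ℕ) (α : FormField n N) (DH DG : ConnOp n N)
    (X Y Z : VField n N) : Prop :=
  ∃ M Q : ℝ × N → ℝ, SmoothFunOn n (collar N ε) M ∧ SmoothFunOn n (collar N ε) Q ∧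
    ∀ p ∈ openCollar N ε, p.2 ∈ O →
      2 * modelMetricPhi 𝓔 gV gB p (conj 𝓔 DH Y p (X p)) (Z p) = M p ∧
      2 * (modelMetricPhi 𝓔 gV gB p (conj 𝓔 DG Y p (X p)) (Z p)
        + p.1 ^ (j + 1) * α p (conj 𝓔 DG Y p (X p)) (Z p)) = M p + p.1 ^ j * Q p

/-- M is chosen before j, α, g and the connection: the same M serves the model and all its
perturbations, which is what makes the comparison at r = 0 possible. -/
theorem exists_pairing_adapted [T2Space N] (hπ : ContMDiff (𝓡 n) (𝓡 m) ∞ π)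
    (gV : VerticalMetric n m π ε)
    (hX : IsAdapted A ε t c X) (hY : IsAdapted A ε t' c' Y) (hZ : IsAdapted A ε t'' c'' Z) :
    ∃ M : ℝ × N → ℝ, SmoothFunOn n (collar N ε) M ∧
      ∀ (j : ℕ) (α g : FormField n N) (D : ConnOp n N), SmoothFormOn (collar N ε) α →
        PerturbedBy 𝓔 gV gB (j + 1) α g →
        (∀ p ∈ openCollar N ε, ∀ v v' : TangentSpace (cylModel n) p, g p v v' = g p v' v) →
        IsLeviCivitaOn (openCollar N ε) g D →
        ∃ Q : ℝ × N → ℝ, SmoothFunOn n (collar N ε) Q ∧ ∀ p ∈ openCollar N ε, p.2 ∈ O →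
          2 * (modelMetricPhi 𝓔 gV gB p (conj 𝓔 D Y p (X p)) (Z p)
            + p.1 ^ (j + 1) * α p (conj 𝓔 D Y p (X p)) (Z p)) = M p + p.1 ^ j * Q p := by
  have sm : ∀ {U V : VField n N}, SmoothFieldOn (collar N ε) U → SmoothFieldOn (collar N ε) V →
      SmoothFunOn n (collar N ε) (fun p => modelMetricPhi 𝓔 gV gB p (U p) (V p)) :=
    fun hU hV => smoothFunOn_modelMetricPhi hπ 𝓔 gV gB hU hV
  have hYX := hX.smooth.bracket hY.smooth
  have hZX := hX.smooth.bracket hZ.smooth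
  have hZY := hY.smooth.bracket hZ.smooth
  -- This is the model part in `koszul_split`. For t = 0 the coefficients 1 - t' and 1 - t'' switch
  -- off the vertical derivatives of h^φ, which vanish for r ≠ 0 but would otherwise carry a factor
  -- r⁻¹.
  refine ⟨fun p => (dirDeriv n ε (fun q => modelMetricPhi 𝓔 gV gB q (Y q) (Z q)) X p
      + (if t = 0 then
          (1 - (t' : ℝ)) * dirDeriv n ε (fun q => modelMetricPhi 𝓔 gV gB q (X q) (Z q)) Y p
          - (1 - (t'' : ℝ)) * dirDeriv n ε (fun q => modelMetricPhi 𝓔 gV gB q (X q) (Y q)) Z p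
        else p.1 ^ (1 - t') * dirDeriv n ε (fun q => modelMetricPhi 𝓔 gV gB q (X q) (Z q)) Y p
          - p.1 ^ (1 - t'') * dirDeriv n ε (fun q => modelMetricPhi 𝓔 gV gB q (X q) (Y q)) Z p)
      + (p.1 ^ (1 - t') *
          modelMetricPhi 𝓔 gV gB p (mlieBracketWithin (cylModel n) X Y (collar N ε) p) (Z p)
        - p.1 ^ (1 - t'') *
          modelMetricPhi 𝓔 gV gB p (mlieBracketWithin (cylModel n) X Z (collar N ε) p) (Y p)
      + (if t = 0 then 0 else
          (1 + (t'' : ℝ)) * c' * modelMetricPhi 𝓔 gV gB p (X p) (Z p)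
          - (1 + (t' : ℝ)) * c'' * modelMetricPhi 𝓔 gV gB p (X p) (Y p)
        - p.1 ^ (2 - t' - t'') *
          modelMetricPhi 𝓔 gV gB p (mlieBracketWithin (cylModel n) Y Z (collar N ε) p) (X p)))),
    ?_, ?_⟩
  · have d1 := (sm hY.smooth hZ.smooth).dirDeriv hX.smooth
    have d2 := (sm hX.smooth hZ.smooth).dirDeriv hY.smooth
    have d3 := (sm hX.smooth hY.smooth).dirDeriv hZ.smooth
    by_cases h : t = 0
    · simp only [h, if_true]
      repeat' first
        | exact smoothFunOn_const _ | exact smoothFunOn_fst_pow _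
        | exact d1 | exact d2 | exact d3 | exact sm hYX hZ.smooth | exact sm hZX hY.smooth
        | apply SmoothFunOn.sub | apply SmoothFunOn.add | apply SmoothFunOn.mul
    · simp only [h, if_false]
      repeat' first
        | exact smoothFunOn_const _ | exact smoothFunOn_fst_pow _
        | exact d1 | exact d2 | exact d3 | exact sm hYX hZ.smooth | exact sm hZX hY.smooth
        | exact sm hZY hX.smooth | exact sm hX.smooth hZ.smooth | exact sm hX.smooth hY.smooth
        | apply SmoothFunOn.sub | apply SmoothFunOn.add | apply SmoothFunOn.mul
  intro j α g D hα hg hsymm hD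
  refine ⟨fun p => p.1 ^ t *
      ((p.1 ^ (1 - t) * dirDeriv n ε (fun q => α q (Y q) (Z q)) X p
          + (j + 1 : ℕ) * c * α p (Y p) (Z p))
        + (p.1 ^ (1 - t') * dirDeriv n ε (fun q => α q (X q) (Z q)) Y p
          + (j + 1 : ℕ) * c' * α p (X p) (Z p))
        - (p.1 ^ (1 - t'') * dirDeriv n ε (fun q => α q (X q) (Y q)) Z p
          + (j + 1 : ℕ) * c'' * α p (X p) (Y p))
        + (p.1 ^ (2 - t - t') * α p (mlieBracketWithin (cylModel n) X Y (collar N ε) p) (Z p)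
          - c * t' * α p (Y p) (Z p) + c' * t * α p (X p) (Z p))
        - (p.1 ^ (2 - t - t'') * α p (mlieBracketWithin (cylModel n) X Z (collar N ε) p) (Y p)
          - c * t'' * α p (Y p) (Z p) + c'' * t * α p (X p) (Y p))
        - (p.1 ^ (2 - t' - t'') * α p (mlieBracketWithin (cylModel n) Y Z (collar N ε) p) (X p)
          - c' * t'' * α p (X p) (Z p) + c'' * t' * α p (X p) (Y p))), ?_, fun p hp hpO => ?_⟩
  · repeat' first
      | exact smoothFunOn_const _ | exact smoothFunOn_fst_pow _
      | exact (hα.apply hY.smooth hZ.smooth).dirDeriv hX.smooth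
      | exact (hα.apply hX.smooth hZ.smooth).dirDeriv hY.smooth
      | exact (hα.apply hX.smooth hY.smooth).dirDeriv hZ.smooth
      | exact hα.apply hYX hZ.smooth | exact hα.apply hZX hY.smooth | exact hα.apply hZY hX.smooth
      | exact hα.apply hY.smooth hZ.smooth | exact hα.apply hX.smooth hZ.smooth
      | exact hα.apply hX.smooth hY.smooth
      | apply SmoothFunOn.sub | apply SmoothFunOn.add | apply SmoothFunOn.mul
  have hpc := openCollar_subset_collar hp
  have hr := fst_ne_zero_of_mem hp
  -- Brackets are vertical, so they have weight 1 whatever the weights of the two fields.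
  have hbr : ∀ {U V : VField n N} {i i' : ℕ} {d d' : ℝ}, IsAdapted A ε i d U →
      IsAdapted A ε i' d' V → phi 𝓔 p (mlieBracketWithin (cylModel n) U V (collar N ε) p) =
        p.1 ^ 1 • mlieBracketWithin (cylModel n) U V (collar N ε) p := by
    intro U V i i' d d' hU hV
    rw [phi, vertScale_apply, hU.vertProj_bracket hV hp hpO, sub_self, zero_add, pow_one]
  have vX := hX.vertScale_eq p.1 hpc hpO
  have vY := hY.vertScale_eq p.1 hpc hpO
  have vZ := hZ.vertScale_eq p.1 hpc hpO
  have hφφ := phi_phiInv 𝓔 p hr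
  have nb : ∀ {U V W : VField n N} {i i' i'' : ℕ} {d d' d'' : ℝ}, IsAdapted A ε i d U →
      IsAdapted A ε i' d' V → IsAdapted A ε i'' d'' W → i'' = 0 →
      modelMetricPhi 𝓔 gV gB p (mlieBracketWithin (cylModel n) U V (collar N ε) p) (W p) = 0 :=
    fun hU hV hW h => modelMetricPhi_vertical_left (hU.vertProj_bracket hV hp hpO)
      (hW.vertProj_eq_zero h hpc hpO)
  refine koszul_split (P := modelMetricPhi 𝓔 gV gB p (conj 𝓔 D Y p (X p)) (Z p)
            + p.1 ^ (j + 1) * α p (conj 𝓔 D Y p (X p)) (Z p))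
    (K := g p (D (fun q => phiInv 𝓔 q (Y q)) p (X p)) (Z p)) hr j hX.zero_or_one hY.zero_or_one
    hZ.zero_or_one hX.coeff_eq_zero hY.coeff_eq_zero hZ.coeff_eq_zero
    (fun h => ⟨hY.modelMetricPhi_eq_zero gV hZ h hpc hpO,
      hY.dirDeriv_modelMetricPhi_eq_zero gV hZ h hp hpO⟩)
    (fun h => ⟨hX.modelMetricPhi_eq_zero gV hZ h hpc hpO,
      hX.dirDeriv_modelMetricPhi_eq_zero gV hZ h hp hpO⟩)
    (fun h => ⟨hX.modelMetricPhi_eq_zero gV hY h hpc hpO,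
      hX.dirDeriv_modelMetricPhi_eq_zero gV hY h hp hpO⟩)
    (fun h h'' h' => hX.dirDeriv_modelMetricPhi_horizontal hπ gV hZ hY h h'' h' hp hpO)
    (fun h h' h'' => hX.dirDeriv_modelMetricPhi_horizontal hπ gV hY hZ h h' h'' hp hpO)
    (nb hX hY hZ) (nb hX hZ hY) (nb hY hZ hX)
    (hg.dirDeriv_adapted hπ hα hX hY hZ hp hpO) (hg.dirDeriv_adapted hπ hα hY hX hZ hp hpO)
    (hg.dirDeriv_adapted hπ hα hZ hX hY hp hpO)
    (hg.apply_smul hp (hbr hX hY) vZ) (hg.apply_smul hp (hbr hX hZ) vY)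
    (hg.apply_smul hp (hbr hY hZ) vX) ?_ ?_
  · rw [← hD.koszul hsymm hX.smooth hY.smooth hZ.smooth hp, hY.conn_apply hD.isConnection hp hpO,
      hX.dr_eq p hpc hpO]
    have hYZ : g p (phiInv 𝓔 p (Y p)) (Z p) = p.1 ^ t'' *
        (modelMetricPhi 𝓔 gV gB p (Y p) (Z p) + p.1 ^ (j + 1) * α p (Y p) (Z p)) := by
      rw [hg.apply hp, (hφφ _).1, phi, vZ]
      simp only [map_smul, smul_eq_mul]
      ring
    simp only [map_add, map_smul, add_apply, smul_apply, smul_eq_mul]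
    rw [hYZ]
    ring
  · rw [conj_apply, hg.apply hp, phi, vZ]
    simp only [map_smul, smul_eq_mul]
    ring

/-- The model is handled with α = 0. Its remainder R is not known to vanish from the existence
statement alone, so r^j R is absorbed into M and R is subtracted from Q. -/
theorem hasPairing_adapted [T2Space N] (hπ : ContMDiff (𝓡 n) (𝓡 m) ∞ π)
    (hX : IsAdapted A ε t c X) (hY : IsAdapted A ε t' c' Y) (hZ : IsAdapted A ε t'' c'' Z)
    {DH DG : ConnOp n N} (hα : SmoothFormOn (collar N ε) α)
    (hg : PerturbedBy 𝓔 gV gB (j + 1) α g)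
    (hsymm : ∀ p ∈ openCollar N ε, ∀ v v' : TangentSpace (cylModel n) p, g p v v' = g p v' v)
    (hDG : IsLeviCivitaOn (openCollar N ε) g DG)
    (hDH : IsLeviCivitaOn (openCollar N ε) (modelMetric 𝓔 gV gB) DH) :
    HasPairing 𝓔 gV gB O j α DH DG X Y Z := by
  obtain ⟨M, hM, h⟩ := exists_pairing_adapted hπ gV hX hY hZ
  obtain ⟨Q, hQ, hQ'⟩ := h j α g DG hα hg hsymm hDG
  obtain ⟨R, hR, hR'⟩ := h j 0 (modelMetric 𝓔 gV gB) DH smoothFormOn_zero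
    (fun p hp v v' => by
      rw [modelMetricPhi_eq 𝓔 gV gB p (fst_ne_zero_of_mem hp)]
      change _ = _ + p.1 ^ (j + 1) * 0
      simp)
    (fun p hp => (isPerturbation_modelMetric 𝓔 gV gB 1).symm p hp) hDH
  refine ⟨fun p => M p + p.1 ^ j * R p, fun p => Q p - R p,
    hM.add ((smoothFunOn_fst_pow j).mul hR), hQ.sub hR, fun p hp hpO => ⟨?_, ?_⟩⟩
  · refine Eq.trans ?_ (hR' p hp hpO)
    change _ = 2 * (_ + p.1 ^ (j + 1) * 0)
    simp
  · refine (hQ' p hp hpO).trans ?_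
    ring

end Pairing

/-! ### From adapted fields to arbitrary fields -/

section Generation

variable {n m : ℕ} {N : Type u} [TopologicalSpace N] [ChartedSpace (EuclideanSpace ℝ (Fin n)) N]
  [IsManifold (𝓡 n) ∞ N]
  {B : Type w} [TopologicalSpace B] [ChartedSpace (EuclideanSpace ℝ (Fin m)) B]
  [IsManifold (𝓡 m) ∞ B] {π : N → B} {ε : ℝ} {X Y Z : VField n N} {g : FormField n N}
  {O : Set N} {𝓔 : EhresmannConnection n m π} {gB : BaseMetric m B}
  {gV : VerticalMetric n m π ε} {α : FormField n N} {j : ℕ} {DH DG : ConnOp n N}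

theorem smoothFieldOn_lift {s : Set (ℝ × N)} {z : Π x : N, TangentSpace (𝓡 n) x}
    (hz : ContMDiff (𝓡 n) (𝓡 n).tangent ∞ (fun x => (⟨x, z x⟩ : TangentBundle (𝓡 n) N))) :
    SmoothFieldOn s (fun p => fromN p (z p.2)) :=
  smoothFieldOn_prod (a := fun _ => 0) (z := fun p => z p.2) contMDiffOn_const
    (hz.comp contMDiff_snd).contMDiffOn

/-- Vector fields on the collar are generated, over `O`, by adapted ones. -/
theorem AdaptedFrame.induction (A : AdaptedFrame 𝓔 gB O) {P : VField n N → Prop}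
    (hcongr : ∀ X Y : VField n N, SmoothFieldOn (collar N ε) X → SmoothFieldOn (collar N ε) Y →
      (∀ q ∈ collar N ε, q.2 ∈ O → X q = Y q) → P X → P Y)
    (hadd : ∀ X Y : VField n N, SmoothFieldOn (collar N ε) X → SmoothFieldOn (collar N ε) Y →
      P X → P Y → P (fun q => X q + Y q))
    (hsmul : ∀ (f : ℝ × N → ℝ) (X : VField n N), SmoothFunOn n (collar N ε) f →
      SmoothFieldOn (collar N ε) X → P X → P (fun q => f q • X q))
    (hadapted : ∀ (t : ℕ) (c : ℝ) (X : VField n N), IsAdapted A ε t c X → P X)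
    (X : VField n N) (hX : SmoothFieldOn (collar N ε) X) : P X := by
  have hV : IsAdapted A ε 1 0 (fun p => vertProj 𝓔 p (X p)) :=
    { smooth := hX.vertProj 𝓔
      zero_or_one := Or.inr rfl
      dr_eq := fun p _ _ => dr_vertProj p _
      coeff_eq_zero := fun _ => rfl
      vertProj_eq := fun _ p _ _ => vertProj_vertProj 𝓔 p _
      toN_eq := fun h => absurd h one_ne_zero }
  have hR : IsAdapted A ε 0 1 (radial n N) :=
    { smooth := smoothFieldOn_radial
      zero_or_one := Or.inl rfl
      dr_eq := fun p _ _ => rfl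
      coeff_eq_zero := fun h => absurd h zero_ne_one
      vertProj_eq := fun h => absurd h zero_ne_one
      toN_eq := fun _ => Or.inl fun p _ _ => rfl }
  have hH : ∀ a, IsAdapted A ε 0 0 (fun p => fromN p (A.field a p.2)) := fun a =>
    { smooth := smoothFieldOn_lift (A.contMDiff_field a)
      zero_or_one := Or.inl rfl
      dr_eq := fun p _ _ => rfl
      coeff_eq_zero := fun h => absurd h zero_ne_one
      vertProj_eq := fun h => absurd h zero_ne_one
      toN_eq := fun _ => Or.inr ⟨a, fun p _ _ => rfl⟩ }
  have hcoef : ∀ a, SmoothFunOn n (collar N ε) (dirDeriv n ε (fun q => A.coord a q.2) X) := fun a =>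
    (smoothFunOn_snd (A.contMDiff_coord a)).dirDeriv hX
  have hsum : ∀ T : Finset (Fin m), SmoothFieldOn (collar N ε)
      (fun p => ∑ a ∈ T, dirDeriv n ε (fun q => A.coord a q.2) X p • fromN p (A.field a p.2)) :=
    fun T => SmoothFieldOn.sum T fun a _ => (hH a).smooth.smul (hcoef a)
  have hPsum : ∀ T : Finset (Fin m),
      P (fun p =>
        ∑ a ∈ T, dirDeriv n ε (fun q => A.coord a q.2) X p • fromN p (A.field a p.2)) := by
    classical
    intro T
    induction T using Finset.induction_on with
    | empty =>
      -- The zero field is obtained as 0 times ∂_r.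
      refine hcongr _ _ (smoothFieldOn_radial.smul (smoothFunOn_const 0)) (hsum ∅) (fun q _ _ => ?_)
        (hsmul _ _ (smoothFunOn_const 0) smoothFieldOn_radial (hadapted _ _ _ hR))
      rw [zero_smul, Finset.sum_empty]
    | insert a T ha ih =>
      have h1 := (hH a).smooth.smul (hcoef a)
      refine hcongr _ _ (h1.add (hsum T)) (hsum _) (fun q _ _ => ?_)
        (hadd _ _ h1 (hsum T) (hsmul _ _ (hcoef a) (hH a).smooth (hadapted _ _ _ (hH a))) ih)
      rw [Finset.sum_insert ha]
  have hVR := hV.smooth.add (smoothFieldOn_radial.smul hX.dr)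
  refine hcongr _ X (hVR.add (hsum Finset.univ)) hX (fun q hq hqO => ?_)
    (hadd _ _ hVR (hsum _) (hadd _ _ hV.smooth (smoothFieldOn_radial.smul hX.dr)
      (hadapted _ _ _ hV) (hsmul _ _ hX.dr smoothFieldOn_radial (hadapted _ _ _ hR))) (hPsum _))
  -- S is the horizontal part of X written in the adapted frame. After removing S and the radial
  -- part, the rest v is killed by dr and all du_a, so it is vertical; having the same vertical
  -- projection as X, it equals that projection.
  set S := ∑ a, dirDeriv n ε (fun q => A.coord a q.2) X q • fromN q (A.field a q.2) with hS
  set v := X q - dr q (X q) • radial n N q - S with hv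
  have hdrS : dr q S = 0 := by
    rw [hS, map_sum]
    refine Finset.sum_eq_zero fun a _ => ?_
    rw [map_smul]
    exact mul_zero _
  have hdrR : dr q (radial n N q) = 1 := rfl
  have hNR : toN q (radial n N q) = 0 := rfl
  have hNS : toN q S = ∑ a, dirDeriv n ε (fun q => A.coord a q.2) X q • A.field a q.2 := by
    rw [hS, map_sum]
    refine Finset.sum_congr rfl fun a _ => ?_
    rw [map_smul]
    rfl
  have hself : vertProj 𝓔 q v = v := by
    refine A.vertProj_eq_self hqO ?_ fun b => ?_
    · rw [hv, map_sub, map_sub, map_smul, hdrS, hdrR]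
      simp
    · rw [hv, map_sub (toN q), map_sub (toN q), map_smul, hNR, hNS, smul_zero, sub_zero, map_sub,
        map_sum,
        ← dirDeriv_snd (A.contMDiff_coord b) hq, Finset.sum_eq_single b]
      · rw [map_smul, A.mvfderiv_coord_field b b q.2 hqO, Matrix.one_apply_eq, smul_eq_mul, mul_one,
          sub_self]
      · intro a _ hab
        rw [map_smul, A.mvfderiv_coord_field b a q.2 hqO, Matrix.one_apply_ne hab.symm, smul_zero]
      · intro h
        exact absurd (Finset.mem_univ b) h
  have hzero : vertProj 𝓔 q S = 0 := by
    rw [hS, map_sum]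
    refine Finset.sum_eq_zero fun a _ => ?_
    rw [map_smul, (hH a).vertProj_eq_zero rfl hq hqO, smul_zero]
  have hVv : vertProj 𝓔 q v = vertProj 𝓔 q (X q) := by
    rw [hv, map_sub, map_sub, map_smul, hzero, hR.vertProj_eq_zero rfl hq hqO, smul_zero, sub_zero,
      sub_zero]
  change vertProj 𝓔 q (X q) + dr q (X q) • radial n N q + S = X q
  rw [← hVv, hself, hv]
  abel

/-- The property is stable under sums and under multiplication of any argument by a function smooth
on the collar, so three inductions, on Y, X and Z, reduce it to adapted fields. -/
theorem hasPairing [T2Space N] (hπ : ContMDiff (𝓡 n) (𝓡 m) ∞ π) (A : AdaptedFrame 𝓔 gB O)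
    (hα : SmoothFormOn (collar N ε) α) (hg : PerturbedBy 𝓔 gV gB (j + 1) α g)
    (hsymm : ∀ p ∈ openCollar N ε, ∀ v v' : TangentSpace (cylModel n) p, g p v v' = g p v' v)
    (hDG : IsLeviCivitaOn (openCollar N ε) g DG)
    (hDH : IsLeviCivitaOn (openCollar N ε) (modelMetric 𝓔 gV gB) DH)
    (hX : SmoothFieldOn (collar N ε) X) (hY : SmoothFieldOn (collar N ε) Y)
    (hZ : SmoothFieldOn (collar N ε) Z) :
    HasPairing 𝓔 gV gB O j α DH DG X Y Z := by
  revert X Z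
  refine A.induction (ε := ε) (P := fun Y => ∀ {X Z : VField n N}, SmoothFieldOn (collar N ε) X →
    SmoothFieldOn (collar N ε) Z → HasPairing 𝓔 gV gB O j α DH DG X Y Z) ?_ ?_ ?_ ?_ Y hY
  · intro Y Y' hY hY' h ih X Z hX hZ
    obtain ⟨M, Q, hM, hQ, hMQ⟩ := ih hX hZ
    refine ⟨M, Q, hM, hQ, fun p hp hpO => ?_⟩
    rw [← conj_congr hDG.isConnection hY hY' A.isOpen h hp hpO,
      ← conj_congr hDH.isConnection hY hY' A.isOpen h hp hpO]
    exact hMQ p hp hpO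
  · intro Y Y' hY hY' ih ih' X Z hX hZ
    obtain ⟨M, Q, hM, hQ, hMQ⟩ := ih hX hZ
    obtain ⟨M', Q', hM', hQ', hMQ'⟩ := ih' hX hZ
    refine ⟨_, _, hM.add hM', hQ.add hQ', fun p hp hpO => ?_⟩
    obtain ⟨e1, e2⟩ := hMQ p hp hpO
    obtain ⟨e1', e2'⟩ := hMQ' p hp hpO
    rw [conj_add hDG.isConnection hY hY' hp, conj_add hDH.isConnection hY hY' hp]
    simp only [map_add, add_apply]
    constructor
    · linear_combination e1 + e1'
    · linear_combination e2 + e2'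
  · intro f Y hf hY ih X Z hX hZ
    obtain ⟨M, Q, hM, hQ, hMQ⟩ := ih hX hZ
    have h1 := smoothFunOn_modelMetricPhi hπ 𝓔 gV gB hY hZ
    have h2 := hα.apply hY hZ
    have hd := hf.dirDeriv hX
    -- The Leibniz term contributes 2 (Xf) h^φ(Y,Z) to M. Its α-part, 2 r^(j+1) (Xf) α(Y,Z), goes
    -- into r^j Q with one factor r to spare.
    refine ⟨_, _, (hf.mul hM).add ((smoothFunOn_const 2).mul (hd.mul h1)),
      (hf.mul hQ).add ((smoothFunOn_const 2).mul (smoothFunOn_fst.mul (hd.mul h2))),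
      fun p hp hpO => ?_⟩
    obtain ⟨e1, e2⟩ := hMQ p hp hpO
    rw [conj_smul hDG.isConnection hf hY hp, conj_smul hDH.isConnection hf hY hp]
    change 2 * modelMetricPhi 𝓔 gV gB p (_ + dirDeriv n ε f X p • _) _ = _ ∧
      2 * (modelMetricPhi 𝓔 gV gB p (_ + dirDeriv n ε f X p • _) _ +
        _ * α p (_ + dirDeriv n ε f X p • _) _) = _
    simp only [map_add, map_smul, add_apply, smul_apply, smul_eq_mul]
    constructor
    · linear_combination f p * e1
    · linear_combination f p * e2
  intro t' c' Y hY
  suffices h : ∀ X : VField n N, SmoothFieldOn (collar N ε) X → ∀ Z : VField n N,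
      SmoothFieldOn (collar N ε) Z → HasPairing 𝓔 gV gB O j α DH DG X Y Z from
    @fun X Z hX hZ => h X hX Z hZ
  refine A.induction ?_ ?_ ?_ ?_
  · intro X X' hX hX' h ih Z hZ
    obtain ⟨M, Q, hM, hQ, hMQ⟩ := ih Z hZ
    refine ⟨M, Q, hM, hQ, fun p hp hpO => ?_⟩
    rw [← h p (openCollar_subset_collar hp) hpO]
    exact hMQ p hp hpO
  · intro X X' hX hX' ih ih' Z hZ
    obtain ⟨M, Q, hM, hQ, hMQ⟩ := ih Z hZ
    obtain ⟨M', Q', hM', hQ', hMQ'⟩ := ih' Z hZ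
    refine ⟨_, _, hM.add hM', hQ.add hQ', fun p hp hpO => ?_⟩
    obtain ⟨e1, e2⟩ := hMQ p hp hpO
    obtain ⟨e1', e2'⟩ := hMQ' p hp hpO
    simp only [map_add, add_apply]
    constructor
    · linear_combination e1 + e1'
    · linear_combination e2 + e2'
  · intro f X hf hX ih Z hZ
    obtain ⟨M, Q, hM, hQ, hMQ⟩ := ih Z hZ
    refine ⟨_, _, hf.mul hM, hf.mul hQ, fun p hp hpO => ?_⟩
    obtain ⟨e1, e2⟩ := hMQ p hp hpO
    simp only [map_smul, smul_apply, smul_eq_mul]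
    constructor
    · linear_combination f p * e1
    · linear_combination f p * e2
  intro t c X hX
  refine A.induction ?_ ?_ ?_ ?_
  · intro Z Z' hZ hZ' h ih
    obtain ⟨M, Q, hM, hQ, hMQ⟩ := ih
    refine ⟨M, Q, hM, hQ, fun p hp hpO => ?_⟩
    rw [← h p (openCollar_subset_collar hp) hpO]
    exact hMQ p hp hpO
  · intro Z Z' hZ hZ' ih ih'
    obtain ⟨M, Q, hM, hQ, hMQ⟩ := ih
    obtain ⟨M', Q', hM', hQ', hMQ'⟩ := ih'
    refine ⟨_, _, hM.add hM', hQ.add hQ', fun p hp hpO => ?_⟩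
    obtain ⟨e1, e2⟩ := hMQ p hp hpO
    obtain ⟨e1', e2'⟩ := hMQ' p hp hpO
    simp only [map_add]
    constructor
    · linear_combination e1 + e1'
    · linear_combination e2 + e2'
  · intro f Z hf hZ ih
    obtain ⟨M, Q, hM, hQ, hMQ⟩ := ih
    refine ⟨_, _, hf.mul hM, hf.mul hQ, fun p hp hpO => ?_⟩
    obtain ⟨e1, e2⟩ := hMQ p hp hpO
    simp only [map_smul, smul_eq_mul]
    constructor
    · linear_combination f p * e1
    · linear_combination f p * e2
  intro t'' c'' Z hZ
  exact hasPairing_adapted hπ hX hY hZ hα hg hsymm hDG hDH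

end Generation

/-! ### Recovering a field from its pairings: the inverse Gram matrix -/

section Resolution

variable {n : ℕ} {N : Type u} [TopologicalSpace N] [ChartedSpace (EuclideanSpace ℝ (Fin n)) N]
  {ε : ℝ} {O : Set N} [IsManifold (𝓡 n) ∞ N]

theorem smoothFunOn_bump_mul {s : Set (ℝ × N)} {ψ : N → ℝ} (hψ : ContMDiff (𝓡 n) 𝓘(ℝ, ℝ) ∞ ψ)
    (hO : IsOpen O) (hsupp : tsupport ψ ⊆ O) {f : ℝ × N → ℝ}
    (hf : SmoothFunOn n (s ∩ {p | p.2 ∈ O}) f) : SmoothFunOn n s (fun p => ψ p.2 * f p) := by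
  intro p hp
  by_cases h : p.2 ∈ O
  · have hnhds : {q : ℝ × N | q.2 ∈ O} ∈ 𝓝 p := (hO.preimage continuous_snd).mem_nhds h
    have h1 := ((smoothFunOn_snd hψ).mul hf : SmoothFunOn n (s ∩ {q | q.2 ∈ O})
      (fun q => ψ q.2 * f q)) p ⟨hp, h⟩
    exact (contMDiffWithinAt_inter hnhds).1 h1
  · have hnhds : ∀ᶠ q : ℝ × N in 𝓝[s] p, ψ q.2 * f q = 0 := by
      have : {q : ℝ × N | q.2 ∈ (tsupport ψ)ᶜ} ∈ 𝓝 p :=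
        ((isClosed_tsupport ψ).isOpen_compl.preimage continuous_snd).mem_nhds fun h' => h (hsupp h')
      filter_upwards [nhdsWithin_le_nhds this] with q hq
      rw [image_eq_zero_of_notMem_tsupport hq, zero_mul]
    exact (contMDiffWithinAt_const (c := (0 : ℝ))).congr_of_eventuallyEq hnhds
      (hnhds.self_of_nhdsWithin hp)

/-- A positive definite form on the collar yields a resolution of the identity: there are local
frames `Z` together with smooth coefficients `H` of the inverse Gram matrix. -/
theorem exists_resolution [T2Space N] {γ : FormField n N}
    (hγ : ∀ X Y : VField n N, SmoothFieldOn (collar N ε) X → SmoothFieldOn (collar N ε) Y →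
      SmoothFunOn n (collar N ε) (fun p => γ p (X p) (Y p)))
    (hpos : ∀ p ∈ collar N ε, ∀ v : TangentSpace (cylModel n) p, v ≠ 0 → 0 < γ p v v) (x₀ : N) :
    ∃ (Z : Option (Fin n) → VField n N) (H : Option (Fin n) → Option (Fin n) → ℝ × N → ℝ)
      (O : Set N), IsOpen O ∧ x₀ ∈ O ∧ (∀ i, SmoothFieldOn (collar N ε) (Z i)) ∧
      (∀ i j, SmoothFunOn n (collar N ε) (H i j)) ∧
      ∀ p ∈ collar N ε, p.2 ∈ O → ∀ v : TangentSpace (cylModel n) p,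
        v = ∑ i, (∑ j, H i j p * γ p v (Z j p)) • Z i p := by
  obtain ⟨z, O', hO', hx, hz, hb⟩ := exists_frame (n := n) x₀
  obtain ⟨ψ, hψ, hsupp, hψ1⟩ := exists_bump (n := n) (hO'.mem_nhds hx)
  let Z : Option (Fin n) → VField n N := fun i => i.elim (radial n N) fun i p => fromN p (z i p.2)
  have hZ : ∀ i, SmoothFieldOn (collar N ε) (Z i) := by
    rintro (_ | i)
    · exact smoothFieldOn_radial
    · exact smoothFieldOn_lift (hz i)
  let G : ℝ × N → Matrix (Option (Fin n)) (Option (Fin n)) ℝ := fun p =>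
    Matrix.of fun i j => γ p (Z i p) (Z j p)
  have hdr : ∀ (p : ℝ × N) (c : Option (Fin n) → ℝ), dr p (∑ i, c i • Z i p) = c none := by
    intro p c
    rw [map_sum, Fintype.sum_option, Finset.sum_eq_zero, add_zero, map_smul]
    · exact mul_one _
    · intro i _
      rw [map_smul]
      exact mul_zero _
  have htoN : ∀ (p : ℝ × N) (c : Option (Fin n) → ℝ),
      toN p (∑ i, c i • Z i p) = ∑ i, c (some i) • z i p.2 := by
    intro p c
    rw [map_sum, Fintype.sum_option, map_smul]
    have h0 : toN p (Z none p) = 0 := rfl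
    rw [h0, smul_zero, zero_add]
    refine Finset.sum_congr rfl fun i _ => ?_
    rw [map_smul]
    rfl
  have hspan : ∀ p : ℝ × N, p.2 ∈ O' → ∀ v : TangentSpace (cylModel n) p,
      ∃ c : Option (Fin n) → ℝ, v = ∑ i, c i • Z i p := by
    intro p hp v
    obtain ⟨b, hb⟩ := hb p.2 hp
    set c : Option (Fin n) → ℝ := fun i => i.elim (dr p v) fun i => b.repr (toN p v) i with hc
    refine ⟨c, Prod.ext (hdr p c).symm (Eq.trans ?_ (htoN p c).symm)⟩
    change toN p v = ∑ i, b.repr (toN p v) i • z i p.2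
    simp only [← hb]
    exact (b.sum_repr _).symm
  have hindep : ∀ p : ℝ × N, p.2 ∈ O' → ∀ c : Option (Fin n) → ℝ, ∑ i, c i • Z i p = 0 → c = 0 := by
    intro p hp c hc
    obtain ⟨b, hb⟩ := hb p.2 hp
    have h1 := hdr p c
    have h2 := htoN p c
    rw [hc, map_zero] at h1 h2
    simp only [← hb] at h2
    have h3 := Fintype.linearIndependent_iff.1 b.linearIndependent (fun i => c (some i)) h2.symm
    funext i
    rcases i with _ | i
    · exact h1.symm
    · exact h3 i
  -- A left null vector c of the Gram matrix gives v = ∑ c_i Z_i with γ(v,v) = 0, hence v = 0 and c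
  -- = 0.
  have hdet : ∀ p ∈ collar N ε ∩ {p | p.2 ∈ O'}, (G p).det ≠ 0 := by
    rintro p ⟨hp, hpO⟩ h0
    obtain ⟨c, hc, hcG⟩ := Matrix.exists_vecMul_eq_zero_iff.2 h0
    refine hc (hindep p hpO c ?_)
    by_contra hne
    refine (hpos p hp _ hne).ne' ?_
    have hj : ∀ j, γ p (∑ i, c i • Z i p) (Z j p) = 0 := by
      intro j
      have := congrFun hcG j
      simp only [Matrix.vecMul, dotProduct, Pi.zero_apply] at this
      rw [map_sum, sum_apply, ← this]
      refine Finset.sum_congr rfl fun i _ => ?_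
      rw [map_smul]
      rfl
    conv_lhs => rw [map_sum (γ p (∑ i, c i • Z i p))]
    refine Finset.sum_eq_zero fun j _ => ?_
    rw [map_smul, hj, smul_zero]
  have hG : ∀ i j, SmoothFunOn n (collar N ε ∩ {p | p.2 ∈ O'}) (fun p => G p i j) := fun i j =>
    (hγ _ _ (hZ i) (hZ j)).mono inter_subset_left
  obtain ⟨O, hO1, hO, hxO⟩ := mem_nhds_iff.1 (Filter.inter_mem (hO'.mem_nhds hx) hψ1)
  -- The pairings γ(v, Z_j) form the row vector c G, as γ need not be symmetric; this explains the
  -- order of the indices of G⁻¹. The factor ψ makes the coefficients smooth on the whole collar and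
  -- is 1 over `O`.
  refine ⟨Z, fun i j p => ψ p.2 * (G p)⁻¹ j i, O, hO, hxO, hZ, fun i j =>
    smoothFunOn_bump_mul hψ hO' hsupp (contMDiffOn_matrix_inv hG hdet j i), fun p hp hpO v => ?_⟩
  obtain ⟨hpO', hψp⟩ := hO1 hpO
  have hψp : ψ p.2 = 1 := hψp
  obtain ⟨c, hc⟩ := hspan p hpO' v
  have hcG : ∀ j, γ p v (Z j p) = (Matrix.vecMul c (G p)) j := by
    intro j
    rw [hc, map_sum, sum_apply]
    change _ = ∑ i, c i * G p i j
    refine Finset.sum_congr rfl fun i _ => ?_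
    rw [map_smul]
    rfl
  have hunit : IsUnit (G p).det := isUnit_iff_ne_zero.2 (hdet p ⟨hp, hpO'⟩)
  have hci : ∀ i, ∑ j, ψ p.2 * (G p)⁻¹ j i * γ p v (Z j p) = c i := by
    intro i
    have h1 : Matrix.vecMul (Matrix.vecMul c (G p)) (G p)⁻¹ = c := by
      rw [Matrix.vecMul_vecMul, Matrix.mul_nonsing_inv _ hunit, Matrix.vecMul_one]
    refine Eq.trans ?_ (congrFun h1 i)
    change _ = ∑ j, Matrix.vecMul c (G p) j * (G p)⁻¹ j i
    refine Finset.sum_congr rfl fun j _ => ?_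
    rw [hcG, hψp, one_mul, mul_comm]
  simp only [hci]
  exact hc

end Resolution

/-! ### Density of r < 0 and uniqueness of extensions -/

section Uniqueness

variable {n m : ℕ} {N : Type u} [TopologicalSpace N] [ChartedSpace (EuclideanSpace ℝ (Fin n)) N]
  [IsManifold (𝓡 n) ∞ N]
  {B : Type w} [TopologicalSpace B] [ChartedSpace (EuclideanSpace ℝ (Fin m)) B]
  [IsManifold (𝓡 m) ∞ B] {π : N → B} {ε : ℝ} {O : Set N}

/-- A boundary point is approached along r → 0⁻ with the point of N fixed, so the path stays over
`O`; continuity concludes. -/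
theorem SmoothFunOn.eq_of_eqOn_openCollar (hε : 0 < ε) {f f' : ℝ × N → ℝ}
    (hf : SmoothFunOn n (collar N ε) f) (hf' : SmoothFunOn n (collar N ε) f')
    (h : ∀ p ∈ openCollar N ε, p.2 ∈ O → f p = f' p) {p : ℝ × N} (hp : p ∈ collar N ε)
    (hpO : p.2 ∈ O) : f p = f' p := by
  rcases collar_eq_or hp with hp' | hp'
  · exact h p hp' hpO
  have hlim : Tendsto (fun r : ℝ => ((r, p.2) : ℝ × N)) (𝓝[<] 0) (𝓝[collar N ε] p) := by
    refine tendsto_nhdsWithin_iff.2 ⟨?_, ?_⟩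
    · have : Continuous fun r : ℝ => ((r, p.2) : ℝ × N) := by fun_prop
      have h1 := this.tendsto 0
      rw [show ((0 : ℝ), p.2) = p from Prod.ext hp'.symm rfl] at h1
      exact h1.mono_left nhdsWithin_le_nhds
    · filter_upwards [Ioo_mem_nhdsLT (neg_lt_zero.2 hε)] with r hr
      exact ⟨⟨hr.1, hr.2.le⟩, mem_univ _⟩
  have h1 := ((hf.continuousOn p hp).tendsto).comp hlim
  have h2 := ((hf'.continuousOn p hp).tendsto).comp hlim
  refine tendsto_nhds_unique (h1.congr' ?_) h2
  filter_upwards [Ioo_mem_nhdsLT (neg_lt_zero.2 hε)] with r hr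
  exact h (r, p.2) ⟨hr, mem_univ _⟩ hpO

/-- Reduces to functions: h^φ(X - Y, X - Y) is smooth on the collar and vanishes for r < 0 over `O`,
while h^φ is definite. -/
theorem SmoothFieldOn.eq_of_eqOn_openCollar (hπ : ContMDiff (𝓡 n) (𝓡 m) ∞ π)
    (𝓔 : EhresmannConnection n m π) (gV : VerticalMetric n m π ε) (gB : BaseMetric m B)
    (hε : 0 < ε) {X Y : VField n N}
    (hX : SmoothFieldOn (collar N ε) X) (hY : SmoothFieldOn (collar N ε) Y)
    (h : ∀ p ∈ openCollar N ε, p.2 ∈ O → X p = Y p) {p : ℝ × N} (hp : p ∈ collar N ε)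
    (hpO : p.2 ∈ O) : X p = Y p := by
  by_contra hne
  refine (modelMetricPhi_pos 𝓔 gV gB hp _ (sub_ne_zero.2 hne)).ne' ?_
  refine SmoothFunOn.eq_of_eqOn_openCollar (O := O) hε
    (smoothFunOn_modelMetricPhi hπ 𝓔 gV gB (hX.sub hY) (hX.sub hY)) (smoothFunOn_const 0)
    (fun q hq hqO => ?_) hp hpO
  rw [h q hq hqO, sub_self, map_zero]

theorem exists_smoothFieldOn_through [T2Space N] (p : ℝ × N) (v : TangentSpace (cylModel n) p) :
    ∃ X : VField n N, SmoothFieldOn (collar N ε) X ∧ X p = v := by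
  obtain ⟨z, hz, hzv⟩ := exists_field_through (n := n) p.2 (toN p v)
  refine ⟨fun q => ((dr p v, z q.2) : ℝ × EuclideanSpace ℝ (Fin n)),
    smoothFieldOn_prod (a := fun _ => dr p v) (z := fun q => z q.2) contMDiffOn_const
      (hz.comp contMDiff_snd).contMDiffOn, ?_⟩
  exact Prod.ext rfl hzv

end Uniqueness

/-! ### Construction of the extended connections and comparison at r = 0 -/

section Extension

variable {n m : ℕ} {N : Type u} [TopologicalSpace N] [ChartedSpace (EuclideanSpace ℝ (Fin n)) N]
  [IsManifold (𝓡 n) ∞ N]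
  {B : Type w} [TopologicalSpace B] [ChartedSpace (EuclideanSpace ℝ (Fin m)) B]
  [IsManifold (𝓡 m) ∞ B] {π : N → B} {ε : ℝ} {O O' : Set N} {X Y Y' Z : VField n N}
  {𝓔 : EhresmannConnection n m π} {gB : BaseMetric m B}
  {gV : VerticalMetric n m π ε} {g α : FormField n N} {j k : ℕ} {D DH DG : ConnOp n N}
  {T T' : Π p : ℝ × N, TangentSpace (cylModel n) p →L[ℝ] TangentSpace (cylModel n) p}

/-- The endomorphism field `T` is smooth on the collar and extends `φ ∇ (φ⁻¹ Y)` over `O`. -/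
structure IsLocalExtension (𝓔 : EhresmannConnection n m π) (ε : ℝ) (D : ConnOp n N)
    (Y : VField n N) (O : Set N)
    (T : Π p : ℝ × N, TangentSpace (cylModel n) p →L[ℝ] TangentSpace (cylModel n) p) : Prop where
  isOpen : IsOpen O
  smooth : ∀ X : VField n N, SmoothFieldOn (collar N ε) X →
    SmoothFieldOn (collar N ε) (fun p => T p (X p))
  eq_conj : ∀ p ∈ openCollar N ε, p.2 ∈ O → conj 𝓔 D Y p = T p

theorem IsLocalExtension.eq [T2Space N] (hπ : ContMDiff (𝓡 n) (𝓡 m) ∞ π)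
    (gV : VerticalMetric n m π ε) (gB : BaseMetric m B) (hε : 0 < ε)
    (hT : IsLocalExtension 𝓔 ε D Y O T) (hT' : IsLocalExtension 𝓔 ε D Y O' T') {p : ℝ × N}
    (hp : p ∈ collar N ε) (hpO : p.2 ∈ O) (hpO' : p.2 ∈ O') : T p = T' p := by
  ext1 v
  obtain ⟨X, hX, hXp⟩ := exists_smoothFieldOn_through (ε := ε) p v
  have := SmoothFieldOn.eq_of_eqOn_openCollar (O := O ∩ O') hπ 𝓔 gV gB hε (hT.smooth X hX)
    (hT'.smooth X hX) (fun q hq hqO => by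
      rw [← hT.eq_conj q hq hqO.1, ← hT'.eq_conj q hq hqO.2]) hp ⟨hpO, hpO'⟩
  rwa [hXp] at this

theorem IsLocalExtension.add (hD : IsConnectionOn (openCollar N ε) D)
    (hY : SmoothFieldOn (collar N ε) Y) (hY' : SmoothFieldOn (collar N ε) Y')
    (hT : IsLocalExtension 𝓔 ε D Y O T) (hT' : IsLocalExtension 𝓔 ε D Y' O' T') :
    IsLocalExtension 𝓔 ε D (fun q => Y q + Y' q) (O ∩ O') (fun p => T p + T' p) where
  isOpen := hT.isOpen.inter hT'.isOpen
  smooth X hX := (hT.smooth X hX).add (hT'.smooth X hX)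
  eq_conj p hp hpO := by
    rw [conj_add hD hY hY' hp, hT.eq_conj p hp hpO.1, hT'.eq_conj p hp hpO.2]

theorem IsLocalExtension.smul (hD : IsConnectionOn (openCollar N ε) D) {f : ℝ × N → ℝ}
    (hf : SmoothFunOn n (collar N ε) f) (hY : SmoothFieldOn (collar N ε) Y)
    (hT : IsLocalExtension 𝓔 ε D Y O T) :
    IsLocalExtension 𝓔 ε D (fun q => f q • Y q) O (fun p => f p • T p +
      ContinuousLinearMap.smulRight (mvfderivWithin (cylModel n) f (collar N ε) p) (Y p)) where
  isOpen := hT.isOpen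
  smooth X hX := ((hT.smooth X hX).smul hf).add (hY.smul (hf.dirDeriv hX))
  eq_conj p hp hpO := by
    ext1 v
    rw [conj_smul hD hf hY hp, hT.eq_conj p hp hpO]
    rfl

/-- The extension of `Y ↦ φ ∇ (φ⁻¹ Y)` down to `r = 0`, where it exists. -/
def boundaryExtension (𝓔 : EhresmannConnection n m π) (ε : ℝ) (D : ConnOp n N) : ConnOp n N :=
  fun Y p => by
    classical
    -- The chosen pair depends on p, but by `IsLocalExtension.eq` its value on the collar does not
    -- depend on the choice. The default 0 plays no role where a local extension exists.
    exact if h : ∃ OT : Set N ×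
        (Π q : ℝ × N, TangentSpace (cylModel n) q →L[ℝ] TangentSpace (cylModel n) q),
        p.2 ∈ OT.1 ∧ IsLocalExtension 𝓔 ε D Y OT.1 OT.2 then h.choose.2 p else 0

theorem IsLocalExtension.boundaryExtension_eq [T2Space N] (hπ : ContMDiff (𝓡 n) (𝓡 m) ∞ π)
    (gV : VerticalMetric n m π ε) (gB : BaseMetric m B) (hε : 0 < ε)
    (hT : IsLocalExtension 𝓔 ε D Y O T) {p : ℝ × N}
    (hp : p ∈ collar N ε) (hpO : p.2 ∈ O) : boundaryExtension 𝓔 ε D Y p = T p := by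
  have h : ∃ OT : Set N ×
      (Π q : ℝ × N, TangentSpace (cylModel n) q →L[ℝ] TangentSpace (cylModel n) q),
      p.2 ∈ OT.1 ∧ IsLocalExtension 𝓔 ε D Y OT.1 OT.2 := ⟨(O, T), hpO, hT⟩
  rw [boundaryExtension, dif_pos h]
  exact h.choose_spec.2.eq hπ gV gB hε hT hp h.choose_spec.1 hpO

theorem isSmoothExtension_boundaryExtension [T2Space N] (hπ : ContMDiff (𝓡 n) (𝓡 m) ∞ π)
    (gV : VerticalMetric n m π ε) (gB : BaseMetric m B) (hε : 0 < ε)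
    (hD : IsConnectionOn (openCollar N ε) D)
    (h : ∀ Y : VField n N, SmoothFieldOn (collar N ε) Y → ∀ x : N,
      ∃ (O : Set N)
        (T : Π p : ℝ × N, TangentSpace (cylModel n) p →L[ℝ] TangentSpace (cylModel n) p),
        x ∈ O ∧ IsLocalExtension 𝓔 ε D Y O T) :
    IsSmoothExtension 𝓔 ε D (boundaryExtension 𝓔 ε D) where
  isConnection :=
    { add := fun Y Y' hY hY' p hp => by
        obtain ⟨O, T, hpO, hT⟩ := h Y hY p.2
        obtain ⟨O', T', hpO', hT'⟩ := h Y' hY' p.2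
        rw [hT.boundaryExtension_eq hπ gV gB hε hp hpO,
          hT'.boundaryExtension_eq hπ gV gB hε hp hpO',
          (hT.add hD hY hY' hT').boundaryExtension_eq hπ gV gB hε hp ⟨hpO, hpO'⟩]
      leibniz := fun f Y hf hY p hp v => by
        obtain ⟨O, T, hpO, hT⟩ := h Y hY p.2
        rw [hT.boundaryExtension_eq hπ gV gB hε hp hpO,
          (hT.smul hD hf hY).boundaryExtension_eq hπ gV gB hε hp hpO]
        rfl
      smooth := fun X Y hX hY p hp => by
        obtain ⟨O, T, hpO, hT⟩ := h Y hY p.2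
        have heq : ∀ q ∈ collar N ε, q.2 ∈ O → boundaryExtension 𝓔 ε D Y q (X q) = T q (X q) :=
          fun q hq hqO => by rw [hT.boundaryExtension_eq hπ gV gB hε hq hqO]
        refine (hT.smooth X hX p hp).congr_of_eventuallyEq ?_ (by simp only [heq p hp hpO])
        filter_upwards [self_mem_nhdsWithin, nhdsWithin_le_nhds
          ((hT.isOpen.preimage continuous_snd).mem_nhds hpO)] with q hq hqO
        rw [heq q hq hqO] }
  eq_conj Y hY p hp v := by
    obtain ⟨O, T, hpO, hT⟩ := h Y hY p.2
    rw [hT.boundaryExtension_eq hπ gV gB hε (openCollar_subset_collar hp) hpO,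
      ← hT.eq_conj p hp hpO, conj_apply]

/-- The form `h^φ + r ^ k α`. -/
def perturbedForm (𝓔 : EhresmannConnection n m π) (gV : VerticalMetric n m π ε)
    (gB : BaseMetric m B) (k : ℕ) (α : FormField n N) : FormField n N :=
  fun p => modelMetricPhi 𝓔 gV gB p + p.1 ^ k • α p

theorem perturbedForm_apply (p : ℝ × N) (v v' : TangentSpace (cylModel n) p) :
    perturbedForm 𝓔 gV gB k α p v v' =
      modelMetricPhi 𝓔 gV gB p v v' + p.1 ^ k * α p v v' := rfl

/-- For r ≠ 0 the form is g pulled back by the invertible φ⁻¹; at r = 0 the exponent j + 1 is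
positive, so only h^φ is left. -/
theorem PerturbedBy.perturbedForm_pos (hg : PerturbedBy 𝓔 gV gB (j + 1) α g)
    (hpos : ∀ p ∈ openCollar N ε, ∀ v : TangentSpace (cylModel n) p, v ≠ 0 → 0 < g p v v)
    {p : ℝ × N} (hp : p ∈ collar N ε) (v : TangentSpace (cylModel n) p) (hv : v ≠ 0) :
    0 < perturbedForm 𝓔 gV gB (j + 1) α p v v := by
  rw [perturbedForm_apply]
  rcases collar_eq_or hp with hp' | hp'
  · rw [← hg p hp']
    refine hpos p hp' _ fun h0 => hv ?_
    rw [← (phi_phiInv 𝓔 p (fst_ne_zero_of_mem hp') v).1, h0, map_zero]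
  · rw [hp', zero_pow j.succ_ne_zero, zero_mul, add_zero]
    exact modelMetricPhi_pos 𝓔 gV gB hp v hv

/-- The covector `v ↦ b v w`. -/
def applyRight {p : ℝ × N}
    (b : TangentSpace (cylModel n) p →L[ℝ] TangentSpace (cylModel n) p →L[ℝ] ℝ)
    (w : TangentSpace (cylModel n) p) : TangentSpace (cylModel n) p →L[ℝ] ℝ :=
  let b' : (ℝ × EuclideanSpace ℝ (Fin n)) →L[ℝ] (ℝ × EuclideanSpace ℝ (Fin n)) →L[ℝ] ℝ := b
  b'.flip w

theorem applyRight_apply {p : ℝ × N}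
    (b : TangentSpace (cylModel n) p →L[ℝ] TangentSpace (cylModel n) p →L[ℝ] ℝ)
    (v w : TangentSpace (cylModel n) p) : applyRight b w v = b v w := rfl

/-- The pairings with a local frame are smooth up to the boundary, and the inverse Gram matrix of
g^φ turns them into smooth fields: the values of the conjugate connection on the frame. Expanding v
in the frame extends this to an endomorphism field. -/
theorem exists_isLocalExtension [T2Space N] (hπ : IsSmoothFiberBundle n m π)
    (hα : SmoothFormOn (collar N ε) α) (hg : PerturbedBy 𝓔 gV gB (j + 1) α g)
    (hsymm : ∀ p ∈ openCollar N ε, ∀ v v' : TangentSpace (cylModel n) p, g p v v' = g p v' v)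
    (hpos : ∀ p ∈ openCollar N ε, ∀ v : TangentSpace (cylModel n) p, v ≠ 0 → 0 < g p v v)
    (hDG : IsLeviCivitaOn (openCollar N ε) g DG)
    (hDH : IsLeviCivitaOn (openCollar N ε) (modelMetric 𝓔 gV gB) DH)
    (hY : SmoothFieldOn (collar N ε) Y) (x : N) :
    ∃ (O : Set N) (T : Π p : ℝ × N, TangentSpace (cylModel n) p →L[ℝ] TangentSpace (cylModel n) p),
      x ∈ O ∧ IsLocalExtension 𝓔 ε DG Y O T := by
  set γ := perturbedForm 𝓔 gV gB (j + 1) α with hγ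
  have hγs : ∀ X Y : VField n N, SmoothFieldOn (collar N ε) X → SmoothFieldOn (collar N ε) Y →
      SmoothFunOn n (collar N ε) (fun p => γ p (X p) (Y p)) := fun X Y hX hY =>
    (smoothFunOn_modelMetricPhi hπ.1 𝓔 gV gB hX hY).add
      ((smoothFunOn_fst_pow _).mul (hα.apply hX hY))
  obtain ⟨Z, H, O₁, hO₁, hx₁, hZ, hH, hres⟩ := exists_resolution (ε := ε) hγs
    (fun p hp v hv => hg.perturbedForm_pos hpos hp v hv) x
  obtain ⟨O₂, hx₂, ⟨A⟩⟩ := exists_adaptedFrame hπ 𝓔 gB x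
  choose M Q hM hQ hMQ using fun i l =>
    hasPairing hπ.1 A hα hg hsymm hDG hDH (hZ i) hY (hZ l)
  -- F i is the extension of D Y (Z i); the factor 1/2 undoes the 2 of the Koszul formula.
  set F : Option (Fin n) → VField n N := fun i p =>
    ∑ k, (∑ l, H k l p * ((1 / 2) * (M i l p + p.1 ^ j * Q i l p))) • Z k p with hF
  have hFs : ∀ i, SmoothFieldOn (collar N ε) (F i) := fun i =>
    SmoothFieldOn.sum _ fun k _ => (hZ k).smul <| contMDiffOn_finsetSum fun l _ =>
      (hH k l).mul ((smoothFunOn_const _).mul ((hM i l).add ((smoothFunOn_fst_pow j).mul (hQ i l))))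
  have hFc : ∀ i, ∀ p ∈ openCollar N ε, p.2 ∈ O₁ ∩ O₂ → conj 𝓔 DG Y p (Z i p) = F i p := by
    rintro i p hp ⟨hp₁, hp₂⟩
    rw [hres p (openCollar_subset_collar hp) hp₁ (conj 𝓔 DG Y p (Z i p))]
    refine Finset.sum_congr rfl fun k _ => ?_
    congr 1
    refine Finset.sum_congr rfl fun l _ => ?_
    rw [hγ, perturbedForm_apply, ← (hMQ i l p hp hp₂).2]
    ring
  refine ⟨O₁ ∩ O₂, fun p => ∑ i, ContinuousLinearMap.smulRight
    (∑ l, H i l p • applyRight (γ p) (Z l p)) (F i p), ⟨hx₁, hx₂⟩, hO₁.inter A.isOpen,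
    fun X hX => ?_, fun p hp hpO => ?_⟩
  · have h1 : SmoothFieldOn (collar N ε)
        (fun p => ∑ i, (∑ l, H i l p * γ p (X p) (Z l p)) • F i p) :=
      SmoothFieldOn.sum _ fun i _ => (hFs i).smul <| contMDiffOn_finsetSum fun l _ =>
        (hH i l).mul (hγs _ _ hX (hZ l))
    refine h1.congr fun p _ => ?_
    simp only [sum_apply, ContinuousLinearMap.smulRight_apply, smul_apply, smul_eq_mul,
      applyRight_apply]
  · ext1 v
    conv_lhs => rw [hres p (openCollar_subset_collar hp) hpO.1 v]
    simp only [map_sum, map_smul, hFc _ p hp hpO, sum_apply, ContinuousLinearMap.smulRight_apply,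
      smul_apply, smul_eq_mul, applyRight_apply]

theorem IsPerturbation.exists_perturbedBy (hg : IsPerturbation 𝓔 gV gB k g) :
    ∃ α : FormField n N, SmoothFormOn (collar N ε) α ∧ PerturbedBy 𝓔 gV gB k α g := by
  obtain ⟨α, hα, -, h⟩ := hg.exists_form
  refine ⟨α, hα, fun p hp v v' => ?_⟩
  rw [h p hp, modelMetricPhi_eq 𝓔 gV gB p (fst_ne_zero_of_mem hp)]

theorem IsPerturbation.isSmoothExtension [T2Space N] (hπ : IsSmoothFiberBundle n m π) (hε : 0 < ε)
    (hg : IsPerturbation 𝓔 gV gB (j + 1) g)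
    (hDG : IsLeviCivitaOn (openCollar N ε) g DG)
    (hDH : IsLeviCivitaOn (openCollar N ε) (modelMetric 𝓔 gV gB) DH) :
    IsSmoothExtension 𝓔 ε DG (boundaryExtension 𝓔 ε DG) := by
  obtain ⟨α, hα, hgα⟩ := hg.exists_perturbedBy
  exact isSmoothExtension_boundaryExtension hπ.1 gV gB hε hDG.isConnection fun Y hY x =>
    exists_isLocalExtension hπ hα hgα hg.symm hg.pos hDG hDH hY x

/-- For r < 0 this is compatibility of ∇ with h, applied to φ⁻¹Y and φ⁻¹Z. Both sides are smooth on
the collar, so it persists at r = 0. -/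
theorem IsSmoothExtension.isMetricOn [T2Space N] (hπ : ContMDiff (𝓡 n) (𝓡 m) ∞ π) (hε : 0 < ε)
    (hD : IsSmoothExtension 𝓔 ε DH D)
    (hDH : IsLeviCivitaOn (openCollar N ε) (modelMetric 𝓔 gV gB) DH) :
    IsMetricOn (collar N ε) (modelMetricPhi 𝓔 gV gB) D := by
  intro Y Z hY hZ p hp v
  obtain ⟨X, hX, rfl⟩ := exists_smoothFieldOn_through (ε := ε) p v
  have hYZ := smoothFunOn_modelMetricPhi hπ 𝓔 gV gB hY hZ
  refine SmoothFunOn.eq_of_eqOn_openCollar (O := univ) hε (hYZ.dirDeriv hX)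
    ((smoothFunOn_modelMetricPhi hπ 𝓔 gV gB (hD.isConnection.smooth X Y hX hY) hZ).add
      (smoothFunOn_modelMetricPhi hπ 𝓔 gV gB hY (hD.isConnection.smooth X Z hX hZ)))
    (fun q hq _ => ?_) hp (mem_univ _)
  have h := hDH.metric _ _ (hY.phiInv 𝓔) (hZ.phiInv 𝓔) q hq (X q)
  have hq0 := fst_ne_zero_of_mem hq
  rw [hD.eq_conj Y hY q hq, hD.eq_conj Z hZ q hq, ← modelMetricPhi_eq 𝓔 gV gB q hq0,
    ← modelMetricPhi_eq 𝓔 gV gB q hq0, (phi_phiInv 𝓔 q hq0 _).2, (phi_phiInv 𝓔 q hq0 _).2, ← h,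
    mvfderivWithin_openCollar _ hq]
  refine dirDeriv_congr (n := n) (ε := ε) ?_
  filter_upwards [isOpen_openCollar.mem_nhds hq] with q' hq'
  rw [modelMetricPhi_eq 𝓔 gV gB q' (fst_ne_zero_of_mem hq')]

/-- The difference of the two extensions, evaluated on X, is paired with itself under h^φ. Second
order means j = 1, so the two pairings have the same M and differ by terms divisible by r. -/
theorem IsSmoothExtension.eq_at_boundary [T2Space N] (hπ : IsSmoothFiberBundle n m π) (hε : 0 < ε)
    (hg : IsPerturbation 𝓔 gV gB 2 g) {DH' DG' : ConnOp n N}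
    (hDG : IsLeviCivitaOn (openCollar N ε) g DG)
    (hDH : IsLeviCivitaOn (openCollar N ε) (modelMetric 𝓔 gV gB) DH)
    (hDH' : IsSmoothExtension 𝓔 ε DH DH') (hDG' : IsSmoothExtension 𝓔 ε DG DG')
    (hY : SmoothFieldOn (collar N ε) Y) {p : ℝ × N} (hp : p.1 = 0) : DG' Y p = DH' Y p := by
  have hpc : p ∈ collar N ε :=
    ⟨⟨by rw [hp]; exact neg_lt_zero.2 hε, hp.le⟩, mem_univ _⟩
  obtain ⟨α, hα, hgα⟩ := hg.exists_perturbedBy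
  obtain ⟨O, hpO, ⟨A⟩⟩ := exists_adaptedFrame hπ 𝓔 gB p.2
  ext1 v
  obtain ⟨X, hX, rfl⟩ := exists_smoothFieldOn_through (ε := ε) p v
  have hGX := hDG'.isConnection.smooth X Y hX hY
  have hHX := hDH'.isConnection.smooth X Y hX hY
  by_contra hne
  refine (modelMetricPhi_pos 𝓔 gV gB hpc _ (sub_ne_zero.2 hne)).ne' ?_
  have hZ := hGX.sub hHX
  obtain ⟨M, Q, hM, hQ, hMQ⟩ := hasPairing (j := 1) hπ.1 A hα hgα hg.symm hDG hDH hX hY hZ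
  have h2 : SmoothFunOn n (collar N ε) fun _ => (2 : ℝ) := smoothFunOn_const 2
  have h1 := SmoothFunOn.eq_of_eqOn_openCollar (O := O) hε
    (h2.mul (smoothFunOn_modelMetricPhi hπ.1 𝓔 gV gB hHX hZ)) hM (fun q hq hqO => by
      rw [← (hMQ q hq hqO).1, conj_apply, ← hDH'.eq_conj Y hY q hq]) hpc hpO
  have h3 := SmoothFunOn.eq_of_eqOn_openCollar (O := O) hε
    (h2.mul ((smoothFunOn_modelMetricPhi hπ.1 𝓔 gV gB hGX hZ).add
      ((smoothFunOn_fst_pow 2).mul (hα.apply hGX hZ)))) (hM.add ((smoothFunOn_fst_pow 1).mul hQ))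
    (fun q hq hqO => by
      rw [← (hMQ q hq hqO).2, conj_apply, ← hDG'.eq_conj Y hY q hq]) hpc hpO
  -- At r = 0 both r² α and r Q drop out, leaving M as twice the h^φ-pairing of either extension
  -- with the difference.
  simp only [hp] at h3
  rw [map_sub (modelMetricPhi 𝓔 gV gB p), sub_apply]
  linear_combination (1 / 2) * h3 - (1 / 2) * h1

end Extension

end EdgeMetric

end

/-! ### The main theorem -/

theorem theorem1p4 {n m : ℕ}
    {N : Type*} [TopologicalSpace N] [T2Space N] [CompactSpace N]
    [ChartedSpace (EuclideanSpace ℝ (Fin n)) N] [IsManifold (𝓡 n) ∞ N]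
    {B : Type*} [TopologicalSpace B] [T2Space B] [CompactSpace B]
    [ChartedSpace (EuclideanSpace ℝ (Fin m)) B] [IsManifold (𝓡 m) ∞ B]
    (π : N → B) (hπ : EdgeMetric.IsSmoothFiberBundle n m π)
    (𝓔 : EdgeMetric.EhresmannConnection n m π)
    (ε : ℝ) (hε : 0 < ε)
    (gV : EdgeMetric.VerticalMetric n m π ε) (gB : EdgeMetric.BaseMetric m B)
    (nablaH : EdgeMetric.ConnOp n N)
    (hH : EdgeMetric.IsLeviCivitaOn (EdgeMetric.openCollar N ε)
      (EdgeMetric.modelMetric 𝓔 gV gB) nablaH) :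
    -- the model metric
    (∃ DH : EdgeMetric.ConnOp n N, EdgeMetric.IsSmoothExtension 𝓔 ε nablaH DH ∧
      EdgeMetric.IsMetricOn (EdgeMetric.collar N ε) (EdgeMetric.modelMetricPhi 𝓔 gV gB) DH) ∧
    -- perturbations of first order
    (∀ (g : EdgeMetric.FormField n N), EdgeMetric.IsPerturbation 𝓔 gV gB 1 g →
      ∀ nablaG : EdgeMetric.ConnOp n N,
        EdgeMetric.IsLeviCivitaOn (EdgeMetric.openCollar N ε) g nablaG →
        ∃ DG : EdgeMetric.ConnOp n N, EdgeMetric.IsSmoothExtension 𝓔 ε nablaG DG) ∧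
    -- perturbations of second order
    (∀ (g : EdgeMetric.FormField n N), EdgeMetric.IsPerturbation 𝓔 gV gB 2 g →
      ∀ nablaG : EdgeMetric.ConnOp n N,
        EdgeMetric.IsLeviCivitaOn (EdgeMetric.openCollar N ε) g nablaG →
        (∃ DG : EdgeMetric.ConnOp n N, EdgeMetric.IsSmoothExtension 𝓔 ε nablaG DG) ∧
        ∀ DH DG : EdgeMetric.ConnOp n N,
          EdgeMetric.IsSmoothExtension 𝓔 ε nablaH DH →
          EdgeMetric.IsSmoothExtension 𝓔 ε nablaG DG →
          ∀ Y : EdgeMetric.VField n N, EdgeMetric.SmoothFieldOn (EdgeMetric.collar N ε) Y →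
            ∀ p : ℝ × N, p.1 = 0 → DG Y p = DH Y p) := by
  have hext := (EdgeMetric.isPerturbation_modelMetric 𝓔 gV gB 1).isSmoothExtension hπ hε hH hH
  exact ⟨⟨_, hext, hext.isMetricOn hπ.1 hε hH⟩,
    fun g hg nablaG hG => ⟨_, hg.isSmoothExtension hπ hε hG hH⟩,
    fun g hg nablaG hG => ⟨⟨_, hg.isSmoothExtension hπ hε hG hH⟩,
      fun DH DG hDH hDG Y hY p hp => hDH.eq_at_boundary hπ hε hg hG hH hDG hY hp⟩⟩
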